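/- Let $R$ be a commutative ring; all schemes, morphisms and products below are over $\operatorname{Spec} R$. Let $G$ be a smooth affine group scheme of finite type over $R$, with multiplication $m$ and unit $e$. Let $Y$ be an $R$-scheme with an action $\sigma : G\times Y\to Y$ of $G$, let $p : G\times Y\to Y$ be the second projection and $p_{23} : G\times G\times Y\to G\times Y$ the projection to the last two factors. A $G$-equivariant quasi-coherent $\mathcal O_Y$-module is a pair $(\mathcal M,\alpha)$ of a quasi-coherent $\mathcal O_Y$-module $\mathcal M$ and an isomorphism $\alpha:\sigma^*\mathcal M\to p^*\mathcal M$ with $(m\times 1)^*\alpha = p_{23}^*\alpha\circ(1\times\sigma)^*\alpha$ and $(e\times 1)^*\alpha=\mathrm{id}_{\mathcal M}$ (under the canonical identifications of iterated pullbacks). A morphism $(\mathcal M,\alpha_{\mathcal M})\to(\mathcal N,\alpha_{\mathcal N})$ is an $\mathcal O_Y$-linear map $\varphi:\mathcal M\to\mathcal N$ with $\alpha_{\mathcal N}\circ\sigma^*\varphi=p^*\varphi\circ\alpha_{\mathcal M}$. The resulting category is denoted $\mathrm{QCoh}(\mathcal O_Y,G)$. Let $\xi:Y\to X$ be a locally trivial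 $G$-torsor. That is: $\xi$ is faithfully flat and locally of finite type, $\xi\circ\sigma=\xi\circ p$, the map $G\times Y\to Y\times_X Y$, $(g,y)\mapsto(gy,y)$, is an isomorphism, and $X$ is covered by affine open subschemes $U$ such that $\mathcal O(U)$ is a finitely generated $R$-algebra and there is a $G$-equivariant isomorphism $G\times U\cong\xi^{-1}(U)$ of $R$-schemes, where $G$ acts on $G\times U$ by left multiplication on the first factor. For $(\mathcal M,\alpha)\in\mathrm{QCoh}(\mathcal O_Y,G)$ let $(\xi_*\mathcal M)^G\subseteq\xi_*\mathcal M$ be the $\mathcal O_X$-submodule whose sections over an open $U\subseteq X$ are the $s\in\mathcal M(\xi^{-1}(U))$ with $\alpha(\sigma^*s)=p^*s$. For $\mathcal N\in\mathrm{QCoh}(\mathcal O_X)$ equip $\xi^*\mathcal N$ with the canonical isomorphism $\sigma^*\xi^*\mathcal N\cong(\xi\circ\sigma)^*\mathcal N=(\xi\circ p)^*\mathcal N\cong p^*\xi^*\mathcal N$. Then $(\xi_*\mathcal M)^G$ is quasi-coherent for every $(\mathcal M,\alpha)\in\mathrm{QCoh}(\mathcal O_Y,G)$, $\xi^*\mathcal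 N$ is quasi-coherent for every $\mathcal N\in\mathrm{QCoh}(\mathcal O_X)$, and the functors $$\xi_*(-)^G:\mathrm{QCoh}(\mathcal O_Y,G)\to\mathrm{QCoh}(\mathcal O_X),\qquad \xi^*:\mathrm{QCoh}(\mathcal O_X)\to\mathrm{QCoh}(\mathcal O_Y,G)$$ are quasi-inverse equivalences of categories. -/

import Mathlib

open CategoryTheory MonoidalCategory CartesianMonoidalCategory MonObj AlgebraicGeometry

universe u

noncomputable section

namespace EquivDescent

/-! ### Pullback of modules along composites -/

section PullbackComp

variable {T Z Y X : Scheme.{u}}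

/-- The canonical isomorphism `a^* b^* ≅ f^*` for `f = b ∘ a`. -/
def pullbackComp' (a : T ⟶ Z) (b : Z ⟶ Y) (f : T ⟶ Y) (h : a ≫ b = f) :
    Scheme.Modules.pullback b ⋙ Scheme.Modules.pullback a ≅ Scheme.Modules.pullback f :=
  Scheme.Modules.pullbackComp a b ≪≫ Scheme.Modules.pullbackCongr h

lemma pullbackComp'_assoc (a : T ⟶ Z) (b : Z ⟶ Y) (c : Y ⟶ X) (ab : T ⟶ Y) (bc : Z ⟶ X)
    (abc : T ⟶ X) (hab : a ≫ b = ab) (hbc : b ≫ c = bc) (h : a ≫ bc = abc) (h' : ab ≫ c = abc)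
    (N : X.Modules) :
    (Scheme.Modules.pullback a).map ((pullbackComp' b c bc hbc).hom.app N) ≫
        (pullbackComp' a bc abc h).hom.app N =
      (pullbackComp' a b ab hab).hom.app ((Scheme.Modules.pullback c).obj N) ≫
        (pullbackComp' ab c abc h').hom.app N := by
  subst hab hbc h'
  have key := congr_arg (fun t => t.app N) (Scheme.Modules.pseudofunctor_associativity a b c)
  simp only [NatTrans.comp_app, Functor.whiskerRight_app, Functor.associator_hom_app,
    Functor.whiskerLeft_app, Category.id_comp, eqToHom_app] at key
  rw [← cancel_epi ((Scheme.Modules.pullback a).map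
      ((pullbackComp' b c _ rfl).inv.app N)), ← Functor.map_comp_assoc, Iso.inv_hom_id_app,
      CategoryTheory.Functor.map_id, Category.id_comp,
      ← cancel_epi ((Scheme.Modules.pullbackComp a (b ≫ c)).inv.app N)]
  simp [pullbackComp', Scheme.Modules.pullbackCongr]
  simpa using key.symm

/-- For `α : σ^* M ⟶ τ^* M` and `a`, the pullback `a^* α`, regarded as a morphism
`f^* M ⟶ g^* M` where `f = σ ∘ a` and `g = τ ∘ a`. -/
def baseChange {M : Y.Modules} {σ τ : Z ⟶ Y}
    (α : (Scheme.Modules.pullback σ).obj M ⟶ (Scheme.Modules.pullback τ).obj M)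
    (a : T ⟶ Z) (f g : T ⟶ Y) (hf : a ≫ σ = f) (hg : a ≫ τ = g) :
    (Scheme.Modules.pullback f).obj M ⟶ (Scheme.Modules.pullback g).obj M :=
  (pullbackComp' a σ f hf).inv.app M ≫ (Scheme.Modules.pullback a).map α ≫
    (pullbackComp' a τ g hg).hom.app M

/-- If `q = ξ ∘ σ = ξ ∘ τ`, the canonical isomorphism `σ^* ξ^* N ≅ q^* N ≅ τ^* ξ^* N`. -/
def canonicalIso (N : X.Modules) (ξ : Y ⟶ X) (σ τ : Z ⟶ Y) (q : Z ⟶ X)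
    (hσ : σ ≫ ξ = q) (hτ : τ ≫ ξ = q) :
    (Scheme.Modules.pullback σ).obj ((Scheme.Modules.pullback ξ).obj N) ≅
      (Scheme.Modules.pullback τ).obj ((Scheme.Modules.pullback ξ).obj N) :=
  (pullbackComp' σ ξ q hσ).app N ≪≫ ((pullbackComp' τ ξ q hτ).app N).symm

lemma baseChange_canonicalIso (N : X.Modules) (ξ : Y ⟶ X) (σ τ : Z ⟶ Y) (q : Z ⟶ X)
    (hσ : σ ≫ ξ = q) (hτ : τ ≫ ξ = q)
    (a : T ⟶ Z) (f g : T ⟶ Y) (hf : a ≫ σ = f) (hg : a ≫ τ = g) (r : T ⟶ X)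
    (hfr : f ≫ ξ = r) (hgr : g ≫ ξ = r) :
    baseChange (canonicalIso N ξ σ τ q hσ hτ).hom a f g hf hg =
      (canonicalIso N ξ f g r hfr hgr).hom := by
  have har : a ≫ q = r := by rw [← hσ, ← hfr, ← hf, Category.assoc]
  have h1 := pullbackComp'_assoc a σ ξ f q r hf hσ har hfr N
  have h2 := pullbackComp'_assoc a τ ξ g q r hg hτ har hgr N
  have h3 : (Scheme.Modules.pullback a).map ((pullbackComp' τ ξ q hτ).inv.app N) ≫
      (pullbackComp' a τ g hg).hom.app ((Scheme.Modules.pullback ξ).obj N) =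
      (pullbackComp' a q r har).hom.app N ≫ (pullbackComp' g ξ r hgr).inv.app N := by
    rw [← cancel_mono ((pullbackComp' g ξ r hgr).hom.app N), Category.assoc, ← h2,
      ← Functor.map_comp_assoc]
    simp
  simp only [baseChange, canonicalIso, Iso.trans_hom, Iso.app_hom, Iso.symm_hom, Iso.app_inv,
    Functor.map_comp, Category.assoc]
  erw [h3]
  rw [reassoc_of% h1]
  simp

end PullbackComp

variable {R : Type u} [CommRing R]

/-! ### The structure morphisms of a group action -/

section Action

variable (G Y : Over (Spec (CommRingCat.of R))) [GrpObj G]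

/-- The projection `p : G × Y ⟶ Y`. -/
abbrev proj : G ⊗ Y ⟶ Y := snd G Y

/-- `m × 1 : G × G × Y ⟶ G × Y`, `(g, h, y) ↦ (gh, y)`. -/
abbrev mulMap : G ⊗ (G ⊗ Y) ⟶ G ⊗ Y := (α_ G G Y).inv ≫ μ[G] ▷ Y

/-- `p₂₃ : G × G × Y ⟶ G × Y`, `(g, h, y) ↦ (h, y)`. -/
abbrev projMap : G ⊗ (G ⊗ Y) ⟶ G ⊗ Y := snd G (G ⊗ Y)

/-- `e × 1 : Y ⟶ G × Y`, `y ↦ (e, y)`. -/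
abbrev unitMap : Y ⟶ G ⊗ Y := lift (toUnit Y ≫ η[G]) (𝟙 Y)

lemma mulMap_proj : mulMap G Y ≫ proj G Y = projMap G Y ≫ proj G Y := by
  simp [mulMap, projMap, proj]

lemma unitMap_proj : unitMap G Y ≫ proj G Y = 𝟙 Y := by
  simp [unitMap, proj]

lemma mulMap_proj_left : (mulMap G Y).left ≫ (proj G Y).left =
    (projMap G Y).left ≫ (proj G Y).left := by
  rw [← Over.comp_left, ← Over.comp_left, mulMap_proj]

lemma unitMap_proj_left : (unitMap G Y).left ≫ (proj G Y).left = 𝟙 Y.left := by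
  rw [← Over.comp_left, unitMap_proj, Over.id_left]

variable [ModObj G Y]

/-- The action `σ : G × Y ⟶ Y`. -/
abbrev act : G ⊗ Y ⟶ Y := ModObj.smul (M := G) (X := Y)

/-- `1 × σ : G × G × Y ⟶ G × Y`, `(g, h, y) ↦ (g, hy)`. -/
abbrev actMap : G ⊗ (G ⊗ Y) ⟶ G ⊗ Y := G ◁ act G Y

lemma mulMap_act : mulMap G Y ≫ act G Y = actMap G Y ≫ act G Y := by
  simp [mulMap, actMap, act]

lemma actMap_proj : actMap G Y ≫ proj G Y = projMap G Y ≫ act G Y := by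
  simp [actMap, projMap, proj]

lemma unitMap_act : unitMap G Y ≫ act G Y = 𝟙 Y := by
  have := one_smul (Y ⟶ G) (𝟙 Y)
  rwa [Hom.smul_def, Hom.one_def] at this

lemma mulMap_act_left : (mulMap G Y).left ≫ (act G Y).left =
    (actMap G Y).left ≫ (act G Y).left := by
  rw [← Over.comp_left, ← Over.comp_left, mulMap_act]

lemma actMap_proj_left : (actMap G Y).left ≫ (proj G Y).left =
    (projMap G Y).left ≫ (act G Y).left := by
  rw [← Over.comp_left, ← Over.comp_left, actMap_proj]

lemma unitMap_act_left : (unitMap G Y).left ≫ (act G Y).left = 𝟙 Y.left := by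
  rw [← Over.comp_left, unitMap_act, Over.id_left]

end Action

/-! ### Equivariant modules -/

section Equivariant

variable (G Y : Over (Spec (CommRingCat.of R))) [GrpObj G] [ModObj G Y]

/-- A `G`-equivariant `𝒪_Y`-module: an `𝒪_Y`-module `M` with an isomorphism `α : σ^* M ≅ p^* M`
satisfying the cocycle condition `(m × 1)^* α = p₂₃^* α ∘ (1 × σ)^* α` on `G × G × Y` and the unit
condition `(e × 1)^* α = id`. Quasi-coherence is imposed separately. -/
structure EquivariantModule where
  /-- the underlying module -/
  obj : Y.left.Modules
  /-- the equivariance structure -/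
  α : (Scheme.Modules.pullback (act G Y).left).obj obj ≅
    (Scheme.Modules.pullback (proj G Y).left).obj obj
  cocycle :
    baseChange α.hom (mulMap G Y).left ((actMap G Y).left ≫ (act G Y).left)
        ((projMap G Y).left ≫ (proj G Y).left) (mulMap_act_left G Y) (mulMap_proj_left G Y) =
      baseChange α.hom (actMap G Y).left ((actMap G Y).left ≫ (act G Y).left)
        ((projMap G Y).left ≫ (act G Y).left) rfl (actMap_proj_left G Y) ≫
      baseChange α.hom (projMap G Y).left ((projMap G Y).left ≫ (act G Y).left)
        ((projMap G Y).left ≫ (proj G Y).left) rfl rfl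
  unit :
    baseChange α.hom (unitMap G Y).left (𝟙 Y.left) (𝟙 Y.left) (unitMap_act_left G Y)
      (unitMap_proj_left G Y) = 𝟙 _

namespace EquivariantModule

variable {G Y}

/-- A morphism of equivariant modules is a morphism `φ` of `𝒪_Y`-modules such that
`α_N ∘ σ^* φ = p^* φ ∘ α_M`. -/
@[ext]
structure Hom (M N : EquivariantModule G Y) where
  /-- the underlying morphism -/
  hom : M.obj ⟶ N.obj
  comm : (Scheme.Modules.pullback (act G Y).left).map hom ≫ N.α.hom =
    M.α.hom ≫ (Scheme.Modules.pullback (proj G Y).left).map hom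

instance : Category (EquivariantModule G Y) where
  Hom := Hom
  id M := ⟨𝟙 _, by simp⟩
  comp f g := ⟨f.hom ≫ g.hom, by
    rw [Functor.map_comp, Functor.map_comp, Category.assoc, g.comm, ← Category.assoc, f.comm,
      Category.assoc]⟩

@[simp] lemma id_hom (M : EquivariantModule G Y) : Hom.hom (𝟙 M) = 𝟙 M.obj := rfl

@[simp] lemma comp_hom {M N P : EquivariantModule G Y} (f : M ⟶ N) (g : N ⟶ P) :
    Hom.hom (f ≫ g) = Hom.hom f ≫ Hom.hom g := rfl

@[ext] lemma hom_ext {M N : EquivariantModule G Y} (f g : M ⟶ N) (h : Hom.hom f = Hom.hom g) :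
    f = g := Hom.ext h

end EquivariantModule

end Equivariant

/-- Quasi-coherence of an `𝒪_X`-module. -/
def isQCoh (X : Scheme.{u}) : ObjectProperty X.Modules := fun M => M.IsQuasicoherent

/-- The category `QCoh(𝒪_X)`. -/
abbrev QCoh (X : Scheme.{u}) := (isQCoh X).FullSubcategory

/-- Quasi-coherence of the module underlying an equivariant module. -/
def isQCohEquivariant (G Y : Over (Spec (CommRingCat.of R))) [GrpObj G] [ModObj G Y] :
    ObjectProperty (EquivariantModule G Y) := fun M => isQCoh Y.left M.obj

/-- The category `QCoh(𝒪_Y, G)` of quasi-coherent `G`-equivariant `𝒪_Y`-modules. -/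
abbrev QCohEquivariant (G Y : Over (Spec (CommRingCat.of R))) [GrpObj G] [ModObj G Y] :=
  (isQCohEquivariant G Y).FullSubcategory

/-! ### The functors `ξ^*` and `(ξ_* -)^G` -/

section Functors

variable {G Y X : Over (Spec (CommRingCat.of R))} [GrpObj G] [ModObj G Y]
  (ξ : Y ⟶ X)

lemma invariant_left (hξ : act G Y ≫ ξ = proj G Y ≫ ξ) :
    (act G Y).left ≫ ξ.left = (proj G Y).left ≫ ξ.left := by
  rw [← Over.comp_left, ← Over.comp_left, hξ]

lemma invariant_left' (hξ : act G Y ≫ ξ = proj G Y ≫ ξ) :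
    ((projMap G Y).left ≫ (act G Y).left) ≫ ξ.left =
    ((projMap G Y).left ≫ (proj G Y).left) ≫ ξ.left := by
  rw [Category.assoc, Category.assoc, invariant_left ξ hξ]

lemma invariant_left'' (hξ : act G Y ≫ ξ = proj G Y ≫ ξ) :
    ((actMap G Y).left ≫ (act G Y).left) ≫ ξ.left =
    ((projMap G Y).left ≫ (proj G Y).left) ≫ ξ.left := by
  rw [← invariant_left' ξ hξ, ← actMap_proj_left, Category.assoc, Category.assoc,
    invariant_left ξ hξ]

/-- The functor `N ↦ (ξ^* N, α)` for a `G`-invariant morphism `ξ`, where `α` is the canonical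
isomorphism `σ^* ξ^* N ≅ (ξ ∘ σ)^* N = (ξ ∘ p)^* N ≅ p^* ξ^* N`. -/
def equivariantPullback (hξ : act G Y ≫ ξ = proj G Y ≫ ξ) :
    X.left.Modules ⥤ EquivariantModule G Y where
  obj N :=
    { obj := (Scheme.Modules.pullback ξ.left).obj N
      α := canonicalIso N ξ.left (act G Y).left (proj G Y).left ((proj G Y).left ≫ ξ.left)
        (invariant_left ξ hξ) rfl
      cocycle := by
        have h1 := invariant_left' ξ hξ
        have h2 := invariant_left'' ξ hξ
        rw [baseChange_canonicalIso _ _ _ _ _ _ _ _ _ _ _ _ _ h2 rfl,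
          baseChange_canonicalIso _ _ _ _ _ _ _ _ _ _ _ _ _ h2 h1,
          baseChange_canonicalIso _ _ _ _ _ _ _ _ _ _ _ _ _ h1 rfl]
        simp [canonicalIso]
      unit := by
        rw [baseChange_canonicalIso _ _ _ _ _ _ _ _ _ _ _ _ ξ.left (Category.id_comp _)
          (Category.id_comp _)]
        simp [canonicalIso] }
  map φ :=
    { hom := (Scheme.Modules.pullback ξ.left).map φ
      comm := by
        have h1 := (pullbackComp' (act G Y).left ξ.left _
          (invariant_left ξ hξ)).hom.naturality φ
        have h2 := (pullbackComp' (proj G Y).left ξ.left ((proj G Y).left ≫ ξ.left) rfl).inv.naturality φ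
        simp only [Functor.comp_map] at h1 h2
        simp only [canonicalIso, Iso.trans_hom, Iso.app_hom, Iso.symm_hom, Iso.app_inv,
          Category.assoc]
        erw [reassoc_of% h1, h2] }
  map_id N := by ext1; simp
  map_comp f g := by ext1; simp

/-- The morphism `ξ_* M ⟶ (ξ ∘ p)_* p^* M` sending a section `m` to `p^* m`. -/
def projSection (M : EquivariantModule G Y) :
    (Scheme.Modules.pushforward ξ.left).obj M.obj ⟶
      (Scheme.Modules.pushforward ((proj G Y).left ≫ ξ.left)).obj
        ((Scheme.Modules.pullback (proj G Y).left).obj M.obj) :=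
  (Scheme.Modules.pushforward ξ.left).map
      ((Scheme.Modules.pullbackPushforwardAdjunction (proj G Y).left).unit.app M.obj) ≫
    (Scheme.Modules.pushforwardComp (proj G Y).left ξ.left).hom.app _

/-- The morphism `ξ_* M ⟶ (ξ ∘ σ)_* p^* M = (ξ ∘ p)_* p^* M` sending a section `m` to
`α (σ^* m)`. -/
def actSection (hξ : act G Y ≫ ξ = proj G Y ≫ ξ)
    (M : EquivariantModule G Y) :
    (Scheme.Modules.pushforward ξ.left).obj M.obj ⟶
      (Scheme.Modules.pushforward ((proj G Y).left ≫ ξ.left)).obj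
        ((Scheme.Modules.pullback (proj G Y).left).obj M.obj) :=
  (Scheme.Modules.pushforward ξ.left).map
      ((Scheme.Modules.pullbackPushforwardAdjunction (act G Y).left).unit.app M.obj) ≫
    (Scheme.Modules.pushforward ξ.left).map
      ((Scheme.Modules.pushforward (act G Y).left).map M.α.hom) ≫
    (Scheme.Modules.pushforwardComp (act G Y).left ξ.left).hom.app _ ≫
    (Scheme.Modules.pushforwardCongr (invariant_left ξ hξ)).hom.app _

lemma projSection_naturality {M N : EquivariantModule G Y} (φ : M ⟶ N) :
    (Scheme.Modules.pushforward ξ.left).map φ.hom ≫ projSection ξ N =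
      projSection ξ M ≫ (Scheme.Modules.pushforward ((proj G Y).left ≫ ξ.left)).map
        ((Scheme.Modules.pullback (proj G Y).left).map φ.hom) := by
  have h1 := (Scheme.Modules.pullbackPushforwardAdjunction (proj G Y).left).unit.naturality φ.hom
  have h2 := (Scheme.Modules.pushforwardComp (proj G Y).left ξ.left).hom.naturality
    ((Scheme.Modules.pullback (proj G Y).left).map φ.hom)
  simp only [Functor.comp_map, Functor.id_map] at h1 h2
  simp only [projSection, Category.assoc]
  rw [← h2, ← Functor.map_comp_assoc, ← Functor.map_comp_assoc, ← h1]

lemma actSection_naturality (hξ : act G Y ≫ ξ = proj G Y ≫ ξ)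
    {M N : EquivariantModule G Y} (φ : M ⟶ N) :
    (Scheme.Modules.pushforward ξ.left).map φ.hom ≫ actSection ξ hξ N =
      actSection ξ hξ M ≫ (Scheme.Modules.pushforward ((proj G Y).left ≫ ξ.left)).map
        ((Scheme.Modules.pullback (proj G Y).left).map φ.hom) := by
  have h1 := (Scheme.Modules.pullbackPushforwardAdjunction (act G Y).left).unit.naturality φ.hom
  have h2 := (Scheme.Modules.pushforwardComp (act G Y).left ξ.left).hom.naturality
    ((Scheme.Modules.pullback (proj G Y).left).map φ.hom)
  have h3 := (Scheme.Modules.pushforwardCongr (invariant_left ξ hξ)).hom.naturality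
    ((Scheme.Modules.pullback (proj G Y).left).map φ.hom)
  have h4 := congrArg (Scheme.Modules.pushforward (act G Y).left).map φ.comm
  simp only [Functor.comp_map, Functor.id_map, Functor.map_comp] at h1 h2 h4
  simp only [actSection, Category.assoc]
  rw [← h3, ← reassoc_of% h2]
  simp only [← Functor.map_comp_assoc]
  rw [← h4, ← reassoc_of% h1]

/-- The functor `M ↦ (ξ_* M)^G` for a `G`-invariant morphism `ξ`: the `𝒪_X`-submodule of `ξ_* M`
whose sections over `U` are the `m ∈ M(ξ⁻¹ U)` with `α (σ^* m) = p^* m`. -/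
def invariantPushforward (hξ : act G Y ≫ ξ = proj G Y ≫ ξ) :
    EquivariantModule G Y ⥤ X.left.Modules where
  obj M := Limits.equalizer (actSection ξ hξ M) (projSection ξ M)
  map {M N} φ := Limits.equalizer.lift
    (Limits.equalizer.ι (actSection ξ hξ M) (projSection ξ M) ≫
      (Scheme.Modules.pushforward ξ.left).map φ.hom) (by
      rw [Category.assoc, Category.assoc, actSection_naturality, projSection_naturality,
        Limits.equalizer.condition_assoc])
  map_id M := by
    apply Limits.equalizer.hom_ext
    refine (Limits.equalizer.lift_ι _ _).trans ?_
    simp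
  map_comp f g := by
    apply Limits.equalizer.hom_ext
    refine (Limits.equalizer.lift_ι _ _).trans ?_
    rw [Category.assoc]
    refine Eq.trans ?_ (congrArg (_ ≫ ·) (Limits.equalizer.lift_ι _ _).symm)
    refine Eq.trans ?_ (Category.assoc _ _ _)
    refine Eq.trans ?_ (congrArg (· ≫ _) (Limits.equalizer.lift_ι _ _).symm)
    simp

end Functors

/-! ### Locally trivial torsors -/

section Torsor

/-- An open subscheme `U` of an `R`-scheme `Z`, as an `R`-scheme. -/
abbrev openOver {Z : Over (Spec (CommRingCat.of R))} (U : Z.left.Opens) :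
    Over (Spec (CommRingCat.of R)) := Over.mk (U.ι ≫ Z.hom)

/-- The inclusion of an open subscheme, as a morphism of `R`-schemes. -/
abbrev openOverι {Z : Over (Spec (CommRingCat.of R))} (U : Z.left.Opens) : openOver U ⟶ Z :=
  Over.homMk U.ι

variable (G : Over (Spec (CommRingCat.of R))) [GrpObj G] {Y X : Over (Spec (CommRingCat.of R))}
  [ModObj G Y]

/-- `ξ : Y ⟶ X` is a `G`-torsor: it is faithfully flat and locally of finite type, it is
`G`-invariant, and `G × Y ⟶ Y ×_X Y`, `(g, y) ↦ (gy, y)` is an isomorphism. -/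
structure IsTorsor (ξ : Y ⟶ X) : Prop where
  flat : Flat ξ.left
  surjective : Surjective ξ.left
  locallyOfFiniteType : LocallyOfFiniteType ξ.left
  invariant : act G Y ≫ ξ = proj G Y ≫ ξ
  isIso : IsIso (Limits.pullback.lift (act G Y) (proj G Y) invariant)

/-- `U` trivialises `ξ`: there is an isomorphism `e : G × U ≅ ξ⁻¹(U)` of `R`-schemes that is
`G`-equivariant (`e(gh, u) = g e(h, u)`), where `G` acts on `G × U` by left multiplication on the
first factor. -/
def Trivialises (ξ : Y ⟶ X) (U : X.left.Opens) : Prop :=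
  ∃ e : G ⊗ openOver U ≅ openOver (ξ.left ⁻¹ᵁ U),
    mulMap G (openOver U) ≫ e.hom ≫ openOverι (ξ.left ⁻¹ᵁ U) =
      G ◁ (e.hom ≫ openOverι (ξ.left ⁻¹ᵁ U)) ≫ act G Y

/-- The `R`-algebra `𝒪(U)` is finitely generated. -/
def SectionsFiniteType (X : Over (Spec (CommRingCat.of R))) (U : X.left.Opens) : Prop :=
  ((Scheme.ΓSpecIso (CommRingCat.of R)).inv ≫ X.hom.appTop ≫
    X.left.presheaf.map (homOfLE (le_top : U ≤ ⊤)).op).hom.FiniteType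

/-- `ξ` is a locally trivial `G`-torsor: a `G`-torsor such that `X` is covered by affine open
subschemes `U` which trivialise `ξ` and for which `𝒪(U)` is a finitely generated `R`-algebra. -/
structure IsLocallyTrivialTorsor (ξ : Y ⟶ X) : Prop extends IsTorsor G ξ where
  exists_trivialising : ∀ x : X.left, ∃ U : X.left.Opens, x ∈ U ∧ IsAffineOpen U ∧
    Trivialises G ξ U ∧ SectionsFiniteType X U

end Torsor

end EquivDescent

end

open EquivDescent

/-! The pullback $\xi^*$ is left adjoint to $(\xi_*-)^G$ on all modules, quasi-coherent or not: a
map $\psi:\xi^*N\to M$ is equivariant exactly when its transpose $N\to\xi_*M$ lands in the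
invariants (`equivariant_iff`). It remains to see that unit and counit are isomorphisms, a local
question on $X$.

Over a trivialising open $U$ there is a section $s$ of $\xi$ (`Trivialises.exists_section`). Each
$y\in\xi^{-1}(U)$ is $g\cdot s(\xi y)$ for a unique $g$, which gives $t:y\mapsto(g,s(\xi y))$ into
$G\times Y$ with $\sigma t(y)=y$ and $p\,t(y)=s(\xi y)$. Pulling $\alpha$ back along $t$ yields
$\alpha_t:M|_{\xi^{-1}(U)}\cong\xi^*s^*M$. The cocycle condition says that $m$ is invariant iff
$\alpha_t(m)$ is of the form $\xi^*n$, so $s^*$ identifies $(\xi_*M)^G$ over $U$ with $s^*M$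
(`LocalSplitting.isIso_comp_pullSection`).

Since $s^*\xi^*$ is restriction to $U$, this says that $s^*$ of the counit is an isomorphism.
Equivariance of the counit moves this along $t$ to all of $\xi^{-1}(U)$ (`isIso_pullback_j_map`).
The triangle identity then makes $\xi^*$ of the unit invertible, and $s^*$ brings this down to $U$.
Quasi-coherence of the invariants follows from the local isomorphism with $s^*M$. -/

noncomputable section

namespace EquivDescent

/-! ### Pullback of sections -/

section PullSection

variable {S T Z Y X : Scheme.{u}}

/-- The pullback `f^* m ∈ Γ(f^* M, f⁻¹(O))` of a section `m ∈ Γ(M, O)`. -/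
def unitSection (f : T ⟶ Y) (M : Y.Modules) (O : Y.Opens) :
    Γ(M, O) ⟶ Γ((Scheme.Modules.pullback f).obj M, f ⁻¹ᵁ O) :=
  ((Scheme.Modules.pullbackPushforwardAdjunction f).unit.app M).app O

lemma app_presheaf_map {M N : Y.Modules} (φ : M ⟶ N) {O O' : Y.Opens} (i : O' ⟶ O) :
    φ.app O ≫ N.presheaf.map i.op = M.presheaf.map i.op ≫ φ.app O' :=
  (φ.mapPresheaf.naturality i.op).symm

lemma map_unitSection (f : T ⟶ Y) (M : Y.Modules) {O O' : Y.Opens} (i : O' ⟶ O) :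
    M.presheaf.map i.op ≫ unitSection f M O' = unitSection f M O ≫
      ((Scheme.Modules.pullback f).obj M).presheaf.map
        (homOfLE (f.preimage_mono (leOfHom i))).op :=
  (app_presheaf_map ((Scheme.Modules.pullbackPushforwardAdjunction f).unit.app M) i).symm

lemma unitSection_naturality (f : T ⟶ Y) {M N : Y.Modules} (φ : M ⟶ N) (O : Y.Opens) :
    unitSection f M O ≫ ((Scheme.Modules.pullback f).map φ).app (f ⁻¹ᵁ O) =
      φ.app O ≫ unitSection f N O :=
  (congr_arg (fun t => t.app O)
    ((Scheme.Modules.pullbackPushforwardAdjunction f).unit.naturality φ)).symm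

/-- The mate of the inverse of `pullbackComp` is the comparison of pushforwards, which is the
identity on sections; the compatibility of units with mates gives the formula. -/
lemma unitSection_comp (a : T ⟶ Z) (b : Z ⟶ Y) (M : Y.Modules) (O : Y.Opens) :
    unitSection b M O ≫ unitSection a _ (b ⁻¹ᵁ O) =
      unitSection (a ≫ b) M O ≫ ((Scheme.Modules.pullbackComp a b).inv.app M).app _ := by
  have key := unit_conjugateEquiv ((Scheme.Modules.pullbackPushforwardAdjunction b).comp
    (Scheme.Modules.pullbackPushforwardAdjunction a))
      (Scheme.Modules.pullbackPushforwardAdjunction (a ≫ b))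
      (Scheme.Modules.pullbackComp a b).inv M
  rw [Scheme.Modules.conjugateEquiv_pullbackComp_inv] at key
  have key' := congr_arg (fun t => t.app O) key
  refine Eq.trans ?_ key'
  exact (Category.comp_id (unitSection b M O ≫ unitSection a _ (b ⁻¹ᵁ O))).symm

/-- The pullback `f^* m ∈ Γ(f^* M, O')` of a section `m ∈ Γ(M, O)`, for `O' ⊆ f⁻¹(O)`. -/
def pullSection (f : T ⟶ Y) (M : Y.Modules) (O : Y.Opens) (O' : T.Opens) (h : O' ≤ f ⁻¹ᵁ O) :
    Γ(M, O) ⟶ Γ((Scheme.Modules.pullback f).obj M, O') :=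
  unitSection f M O ≫ ((Scheme.Modules.pullback f).obj M).presheaf.map (homOfLE h).op

lemma pullSection_eq_unitSection (f : T ⟶ Y) (M : Y.Modules) (O : Y.Opens) :
    pullSection f M O (f ⁻¹ᵁ O) le_rfl = unitSection f M O := by
  have : (homOfLE (le_refl (f ⁻¹ᵁ O))) = 𝟙 _ := rfl
  rw [pullSection, this, op_id, CategoryTheory.Functor.map_id, Category.comp_id]

lemma map_pullSection (f : T ⟶ Y) (M : Y.Modules) {O₁ O : Y.Opens} {O' : T.Opens}
    (i : O ⟶ O₁) (h : O' ≤ f ⁻¹ᵁ O) :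
    M.presheaf.map i.op ≫ pullSection f M O O' h =
      pullSection f M O₁ O' (h.trans (f.preimage_mono (leOfHom i))) := by
  rw [pullSection, pullSection, reassoc_of% map_unitSection, ← Functor.map_comp]
  rfl

lemma pullSection_naturality (f : T ⟶ Y) {M N : Y.Modules} (φ : M ⟶ N) (O : Y.Opens)
    (O' : T.Opens) (h : O' ≤ f ⁻¹ᵁ O) :
    pullSection f M O O' h ≫ ((Scheme.Modules.pullback f).map φ).app O' =
      φ.app O ≫ pullSection f N O O' h := by
  rw [pullSection, pullSection, Category.assoc, ← app_presheaf_map, reassoc_of% unitSection_naturality]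

/-- This is `unitSection_comp` with all restrictions moved to the end. Leaving the opens free avoids
transport between preimages that are only propositionally equal. -/
lemma pullSection_pullbackComp' (a : T ⟶ Z) (b : Z ⟶ Y) (f : T ⟶ Y) (hf : a ≫ b = f)
    (M : Y.Modules) (O : Y.Opens) (O' : Z.Opens) (O'' : T.Opens) (h : O' ≤ b ⁻¹ᵁ O)
    (h' : O'' ≤ a ⁻¹ᵁ O') (h'' : O'' ≤ f ⁻¹ᵁ O) :
    pullSection b M O O' h ≫ pullSection a _ O' O'' h' ≫
      ((pullbackComp' a b f hf).hom.app M).app O'' = pullSection f M O O'' h'' := by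
  subst hf
  have e1 : ((pullbackComp' a b _ rfl).hom.app M) = (Scheme.Modules.pullbackComp a b).hom.app M := by
    simp [pullbackComp', Scheme.Modules.pullbackCongr]
  have e2 : ((Scheme.Modules.pullbackComp a b).inv.app M).app O'' ≫
     ((Scheme.Modules.pullbackComp a b).hom.app M).app O'' = 𝟙 _ := by
    rw [← Scheme.Modules.Hom.comp_app, Iso.inv_hom_id_app]; rfl
  have e3 := congr_arg (· ≫ ((Scheme.Modules.pullback a).obj
    ((Scheme.Modules.pullback b).obj M)).presheaf.map (homOfLE h'').op ≫
      ((Scheme.Modules.pullbackComp a b).hom.app M).app O'') (unitSection_comp a b M O)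
  rw [e1, pullSection, Category.assoc, reassoc_of% map_pullSection, pullSection, pullSection,
    Category.assoc]
  simp only [Category.assoc] at e3
  refine e3.trans ?_
  congr 1
  have e4 := app_presheaf_map ((Scheme.Modules.pullbackComp a b).inv.app M) (homOfLE h'')
  refine (congr_arg (· ≫ ((Scheme.Modules.pullbackComp a b).hom.app M).app O'') e4).trans ?_
  refine (Category.assoc _ _ _).trans ?_
  rw [e2, Category.comp_id]

lemma pullSection_inv_pullbackComp' (a : T ⟶ Z) (b : Z ⟶ Y) (f : T ⟶ Y) (hf : a ≫ b = f)
    (M : Y.Modules) (O : Y.Opens) (O' : Z.Opens) (O'' : T.Opens) (h : O' ≤ b ⁻¹ᵁ O)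
    (h' : O'' ≤ a ⁻¹ᵁ O') (h'' : O'' ≤ f ⁻¹ᵁ O) :
    pullSection f M O O'' h'' ≫ ((pullbackComp' a b f hf).inv.app M).app O'' =
      pullSection b M O O' h ≫ pullSection a _ O' O'' h' := by
  rw [← pullSection_pullbackComp' a b f hf M O O' O'' h h' h'', Category.assoc, Category.assoc,
    ← Scheme.Modules.Hom.comp_app, Iso.hom_inv_id_app]
  simp

/-- Pullback of sections along an open immersion is an isomorphism. -/
lemma isIso_pullSection (f : T ⟶ Y) [IsOpenImmersion f] (M : Y.Modules) (O : Y.Opens)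
    (O' : T.Opens) (h : O' ≤ f ⁻¹ᵁ O) (h' : O' = f ⁻¹ᵁ O) (hO : O ≤ f.opensRange) :
    IsIso (pullSection f M O O' h) := by
  subst h'
  -- Uniqueness of left adjoints identifies $f^*$ with restriction to the open subscheme. The unit
  -- then becomes restriction from $O$ to $f(f^{-1}O)$, which equals $O$ when $O$ lies in the range.
  have key := (Scheme.Modules.restrictAdjunction f).unit_leftAdjointUniq_hom_app
    (Scheme.Modules.pullbackPushforwardAdjunction f) M
  have key' : M.presheaf.map (homOfLE (f.image_preimage_le O)).op ≫
      (((Scheme.Modules.restrictAdjunction f).leftAdjointUniq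
        (Scheme.Modules.pullbackPushforwardAdjunction f)).hom.app M).app (f ⁻¹ᵁ O) =
      unitSection f M O := congr_arg (fun t => t.app O) key
  rw [pullSection_eq_unitSection, ← key']
  have h1 : f ''ᵁ f ⁻¹ᵁ O = O := by
    rw [Scheme.Hom.image_preimage_eq_opensRange_inf]; exact inf_eq_right.2 hO
  have h2 : homOfLE (f.image_preimage_le O) = eqToHom h1 := rfl
  rw [h2]
  have : IsIso ((((Scheme.Modules.restrictAdjunction f).leftAdjointUniq
      (Scheme.Modules.pullbackPushforwardAdjunction f)).hom.app M).app (f ⁻¹ᵁ O)) := inferInstance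
  have : IsIso (M.presheaf.map (eqToHom h1).op) :=
    Functor.map_isIso M.presheaf (eqToHom h1).op
  exact IsIso.comp_isIso' ‹_› ‹_›

end PullSection

variable {R : Type u} [CommRing R]

/-! ### The adjunction between `ξ^*` and `(ξ_* -)^G` -/

section Adjunction

variable {G Y X : Over (Spec (CommRingCat.of R))} [GrpObj G] [ModObj G Y]
  (ξ : Y ⟶ X)

lemma preimage_le_act (hξ : act G Y ≫ ξ = proj G Y ≫ ξ) (U : X.left.Opens) :
    ((proj G Y).left ≫ ξ.left) ⁻¹ᵁ U ≤ (act G Y).left ⁻¹ᵁ ξ.left ⁻¹ᵁ U := by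
  rw [← invariant_left ξ hξ]; exact le_rfl

lemma projSection_app (M : EquivariantModule G Y) (U : X.left.Opens) :
    (projSection ξ M).app U = pullSection (proj G Y).left M.obj (ξ.left ⁻¹ᵁ U)
      (((proj G Y).left ≫ ξ.left) ⁻¹ᵁ U) le_rfl := by
  refine Eq.trans ?_ (pullSection_eq_unitSection (proj G Y).left M.obj (ξ.left ⁻¹ᵁ U)).symm
  exact Category.comp_id (unitSection (proj G Y).left M.obj (ξ.left ⁻¹ᵁ U))

/-- On sections `pushforwardCongr` is restriction along the equality of the two preimages of $U$;
the target open of `pullSection` absorbs it. -/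
lemma actSection_app (hξ : act G Y ≫ ξ = proj G Y ≫ ξ) (M : EquivariantModule G Y)
    (U : X.left.Opens) :
    (actSection ξ hξ M).app U = pullSection (act G Y).left M.obj (ξ.left ⁻¹ᵁ U)
      (((proj G Y).left ≫ ξ.left) ⁻¹ᵁ U) (preimage_le_act ξ hξ U) ≫ M.α.hom.app _ := by
  have e : (actSection ξ hξ M).app U = unitSection (act G Y).left M.obj (ξ.left ⁻¹ᵁ U) ≫
      M.α.hom.app _ ≫ ((Scheme.Modules.pullback (proj G Y).left).obj M.obj).presheaf.map
        (homOfLE (preimage_le_act ξ hξ U)).op := by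
    have e1 : ((Scheme.Modules.pushforwardCongr (invariant_left ξ hξ)).hom.app
        ((Scheme.Modules.pullback (proj G Y).left).obj M.obj)).app U =
        ((Scheme.Modules.pullback (proj G Y).left).obj M.obj).presheaf.map
          (homOfLE (preimage_le_act ξ hξ U)).op :=
      Scheme.Modules.pushforwardCongr_hom_app_app _ _
    rw [← e1]
    rfl
  rw [e, app_presheaf_map, pullSection, Category.assoc]

/-- The canonical isomorphism on `ξ^* N` sends `σ^* ξ^* n` to `p^* ξ^* n`. -/
lemma pullSection_canonicalIso {Z Y X : Scheme.{u}} (N : X.Modules) (ξ : Y ⟶ X) (σ τ : Z ⟶ Y)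
    (q : Z ⟶ X) (hσ : σ ≫ ξ = q) (hτ : τ ≫ ξ = q) (U : X.Opens) (O : Y.Opens) (O' : Z.Opens)
    (h : O ≤ ξ ⁻¹ᵁ U) (h₁ : O' ≤ σ ⁻¹ᵁ O) (h₂ : O' ≤ τ ⁻¹ᵁ O) :
    pullSection ξ N U O h ≫ pullSection σ _ O O' h₁ ≫
      (canonicalIso N ξ σ τ q hσ hτ).hom.app O' =
      pullSection ξ N U O h ≫ pullSection τ _ O O' h₂ := by
  have hq : O' ≤ q ⁻¹ᵁ U := by rw [← hσ]; exact h₁.trans (σ.preimage_mono h)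
  rw [← pullSection_inv_pullbackComp' τ ξ q hτ N U O O' h h₂ hq,
    ← pullSection_pullbackComp' σ ξ q hσ N U O O' h h₁ hq]
  simp only [Category.assoc]
  rfl

/-- A morphism `ψ : ξ^* N ⟶ M` is compatible with the canonical isomorphism on `ξ^* N` and with
`α : σ^* M ⟶ τ^* M` if and only if `α (σ^* ψ (ξ^* n)) = τ^* ψ (ξ^* n)` for all sections `n`. -/
lemma compatible_iff {Z Y X : Scheme.{u}} (ξ : Y ⟶ X) (σ τ : Z ⟶ Y)
    (q : Z ⟶ X) (hσ : σ ≫ ξ = q) (hτ : τ ≫ ξ = q) (N : X.Modules) (M : Y.Modules)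
    (α : (Scheme.Modules.pullback σ).obj M ⟶ (Scheme.Modules.pullback τ).obj M)
    (ψ : (Scheme.Modules.pullback ξ).obj N ⟶ M)
    (hσ' : ∀ U, q ⁻¹ᵁ U ≤ σ ⁻¹ᵁ ξ ⁻¹ᵁ U) (hτ' : ∀ U, q ⁻¹ᵁ U ≤ τ ⁻¹ᵁ ξ ⁻¹ᵁ U) :
    (Scheme.Modules.pullback σ).map ψ ≫ α =
      (canonicalIso N ξ σ τ q hσ hτ).hom ≫ (Scheme.Modules.pullback τ).map ψ ↔
    ∀ U, unitSection ξ N U ≫ ψ.app _ ≫ pullSection σ M (ξ ⁻¹ᵁ U) (q ⁻¹ᵁ U) (hσ' U) ≫ α.app _ =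
      unitSection ξ N U ≫ ψ.app _ ≫ pullSection τ M (ξ ⁻¹ᵁ U) (q ⁻¹ᵁ U) (hτ' U) := by
  have h1 : ∀ U, unitSection ξ N U ≫ ψ.app _ ≫
      pullSection σ M (ξ ⁻¹ᵁ U) (q ⁻¹ᵁ U) (hσ' U) ≫ α.app _ =
      unitSection ξ N U ≫ pullSection σ _ (ξ ⁻¹ᵁ U) (q ⁻¹ᵁ U) (hσ' U) ≫
        ((Scheme.Modules.pullback σ).map ψ ≫ α).app _ := fun U => by
    rw [Scheme.Modules.Hom.comp_app, reassoc_of% pullSection_naturality]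
  have h2 : ∀ U, unitSection ξ N U ≫ ψ.app _ ≫
      pullSection τ M (ξ ⁻¹ᵁ U) (q ⁻¹ᵁ U) (hτ' U) =
      unitSection ξ N U ≫ pullSection σ _ (ξ ⁻¹ᵁ U) (q ⁻¹ᵁ U) (hσ' U) ≫
        ((canonicalIso N ξ σ τ q hσ hτ).hom ≫ (Scheme.Modules.pullback τ).map ψ).app _ :=
      fun U => by
    have := pullSection_canonicalIso N ξ σ τ q hσ hτ U _ _ le_rfl (hσ' U) (hτ' U)
    rw [pullSection_eq_unitSection] at this
    rw [Scheme.Modules.Hom.comp_app, ← pullSection_naturality, reassoc_of% this]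
  constructor
  · intro h U
    rw [h1, h2, h]
  · intro h
    simp only [h1, h2] at h
    clear h1 h2
    generalize (canonicalIso N ξ σ τ q hσ hτ).hom ≫ (Scheme.Modules.pullback τ).map ψ = B at h ⊢
    subst hσ
    -- Transposing twice: a morphism out of $\sigma^*\xi^*N$ is determined by its values on the
    -- sections $\sigma^*\xi^*n$.
    apply ((Scheme.Modules.pullbackPushforwardAdjunction σ).homEquiv _ _).injective
    apply ((Scheme.Modules.pullbackPushforwardAdjunction ξ).homEquiv _ _).injective
    ext1 U
    have := h U
    have e : pullSection σ ((Scheme.Modules.pullback ξ).obj N) (ξ ⁻¹ᵁ U) ((σ ≫ ξ) ⁻¹ᵁ U) (hσ' U) =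
      unitSection σ _ (ξ ⁻¹ᵁ U) := pullSection_eq_unitSection σ _ (ξ ⁻¹ᵁ U)
    simp only [e] at this
    simp only [Adjunction.homEquiv_unit]
    exact this

/-- The inclusion `(ξ_* M)^G ⟶ ξ_* M`. -/
def invariantι (hξ : act G Y ≫ ξ = proj G Y ≫ ξ) (M : EquivariantModule G Y) :
    (invariantPushforward ξ hξ).obj M ⟶ (Scheme.Modules.pushforward ξ.left).obj M.obj :=
  Limits.equalizer.ι (actSection ξ hξ M) (projSection ξ M)

lemma invariantι_condition (hξ : act G Y ≫ ξ = proj G Y ≫ ξ) (M : EquivariantModule G Y) :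
    invariantι ξ hξ M ≫ actSection ξ hξ M = invariantι ξ hξ M ≫ projSection ξ M :=
  Limits.equalizer.condition _ _

lemma invariantPushforward_map_ι (hξ : act G Y ≫ ξ = proj G Y ≫ ξ) {M N : EquivariantModule G Y}
    (φ : M ⟶ N) : (invariantPushforward ξ hξ).map φ ≫ invariantι ξ hξ N =
      invariantι ξ hξ M ≫ (Scheme.Modules.pushforward ξ.left).map φ.hom :=
  Limits.equalizer.lift_ι _ _

/-- A morphism to `ξ_* M` with image in the invariants lifts to `(ξ_* M)^G`. -/
def invariantLift (hξ : act G Y ≫ ξ = proj G Y ≫ ξ) (M : EquivariantModule G Y)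
    {N : X.left.Modules} (φ : N ⟶ (Scheme.Modules.pushforward ξ.left).obj M.obj)
    (h : φ ≫ actSection ξ hξ M = φ ≫ projSection ξ M) :
    N ⟶ (invariantPushforward ξ hξ).obj M :=
  Limits.equalizer.lift φ h

lemma invariantLift_ι (hξ : act G Y ≫ ξ = proj G Y ≫ ξ) (M : EquivariantModule G Y)
    {N : X.left.Modules} (φ : N ⟶ (Scheme.Modules.pushforward ξ.left).obj M.obj)
    (h : φ ≫ actSection ξ hξ M = φ ≫ projSection ξ M) :
    invariantLift ξ hξ M φ h ≫ invariantι ξ hξ M = φ :=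
  Limits.equalizer.lift_ι _ _

lemma invariant_hom_ext (hξ : act G Y ≫ ξ = proj G Y ≫ ξ) {M : EquivariantModule G Y}
    {N : X.left.Modules} {φ ψ : N ⟶ (invariantPushforward ξ hξ).obj M}
    (h : φ ≫ invariantι ξ hξ M = ψ ≫ invariantι ξ hξ M) : φ = ψ :=
  Limits.equalizer.hom_ext h

/-- `ψ : ξ^* N ⟶ M` is equivariant if and only if its adjoint `N ⟶ ξ_* M` has image in the
invariants. -/
lemma equivariant_iff (hξ : act G Y ≫ ξ = proj G Y ≫ ξ) (N : X.left.Modules)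
    (M : EquivariantModule G Y) (ψ : (Scheme.Modules.pullback ξ.left).obj N ⟶ M.obj) :
    ((Scheme.Modules.pullback (act G Y).left).map ψ ≫ M.α.hom =
      ((equivariantPullback ξ hξ).obj N).α.hom ≫
        (Scheme.Modules.pullback (proj G Y).left).map ψ) ↔
    (Scheme.Modules.pullbackPushforwardAdjunction ξ.left).homEquiv _ _ ψ ≫ actSection ξ hξ M =
      (Scheme.Modules.pullbackPushforwardAdjunction ξ.left).homEquiv _ _ ψ ≫
        projSection ξ M := by
  refine (compatible_iff ξ.left (act G Y).left (proj G Y).left ((proj G Y).left ≫ ξ.left)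
        (invariant_left ξ hξ) rfl N M.obj M.α.hom ψ (preimage_le_act ξ hξ)
        (fun _ => le_rfl)).trans ?_
  have hadj : ∀ U, ((Scheme.Modules.pullbackPushforwardAdjunction ξ.left).homEquiv _ _ ψ).app U =
      unitSection ξ.left N U ≫ ψ.app _ := fun U => by
    rw [Adjunction.homEquiv_unit]; rfl
  have h (U) : (unitSection ξ.left N U ≫ ψ.app _ ≫ pullSection (act G Y).left M.obj (ξ.left ⁻¹ᵁ U)
      (((proj G Y).left ≫ ξ.left) ⁻¹ᵁ U) (preimage_le_act ξ hξ U) ≫ M.α.hom.app _ =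
      unitSection ξ.left N U ≫ ψ.app _ ≫ pullSection (proj G Y).left M.obj (ξ.left ⁻¹ᵁ U)
        (((proj G Y).left ≫ ξ.left) ⁻¹ᵁ U) le_rfl) ↔
      ((Scheme.Modules.pullbackPushforwardAdjunction ξ.left).homEquiv _ _ ψ ≫
        actSection ξ hξ M).app U =
      ((Scheme.Modules.pullbackPushforwardAdjunction ξ.left).homEquiv _ _ ψ ≫
        projSection ξ M).app U := by
    rw [Scheme.Modules.Hom.comp_app, Scheme.Modules.Hom.comp_app, hadj, actSection_app,
      projSection_app]
    exact Iff.of_eq (congr_arg₂ (· = ·) (Category.assoc _ _ _).symm (Category.assoc _ _ _).symm)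
  exact ⟨fun h' => Scheme.Modules.hom_ext _ _ fun U => (h U).1 (h' U),
    fun h' U => (h U).2 (congr_arg (fun t => t.app U) h')⟩

/-- Equivariant morphisms `ξ^* N ⟶ M` correspond to morphisms `N ⟶ (ξ_* M)^G`. -/
def invariantHomEquiv (hξ : act G Y ≫ ξ = proj G Y ≫ ξ) (N : X.left.Modules)
    (M : EquivariantModule G Y) :
    ((equivariantPullback ξ hξ).obj N ⟶ M) ≃ (N ⟶ (invariantPushforward ξ hξ).obj M) where
  toFun ψ := invariantLift ξ hξ M
    ((Scheme.Modules.pullbackPushforwardAdjunction ξ.left).homEquiv N M.obj ψ.hom)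
    ((equivariant_iff ξ hξ N M ψ.hom).1 ψ.comm)
  invFun φ :=
    { hom := ((Scheme.Modules.pullbackPushforwardAdjunction ξ.left).homEquiv N M.obj).symm
        (φ ≫ invariantι ξ hξ M)
      comm := (equivariant_iff ξ hξ N M _).2 (by
        rw [Equiv.apply_symm_apply, Category.assoc, Category.assoc, invariantι_condition]) }
  left_inv ψ := by
    apply EquivariantModule.hom_ext
    refine (congr_arg ((Scheme.Modules.pullbackPushforwardAdjunction ξ.left).homEquiv
      N M.obj).symm (invariantLift_ι ξ hξ M _ _)).trans ?_
    exact Equiv.symm_apply_apply _ _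
  right_inv φ := by
    apply invariant_hom_ext
    rw [invariantLift_ι]
    exact Equiv.apply_symm_apply _ _

lemma invariantHomEquiv_ι (hξ : act G Y ≫ ξ = proj G Y ≫ ξ) (N : X.left.Modules)
    (M : EquivariantModule G Y) (ψ : (equivariantPullback ξ hξ).obj N ⟶ M) :
    invariantHomEquiv ξ hξ N M ψ ≫ invariantι ξ hξ M =
      (Scheme.Modules.pullbackPushforwardAdjunction ξ.left).homEquiv N M.obj ψ.hom :=
  invariantLift_ι _ _ _ _ _

/-- `ξ^*` is left adjoint to `(ξ_* -)^G`. -/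
def invariantAdjunction (hξ : act G Y ≫ ξ = proj G Y ≫ ξ) :
    equivariantPullback ξ hξ ⊣ invariantPushforward ξ hξ :=
  Adjunction.mkOfHomEquiv
    { homEquiv := invariantHomEquiv ξ hξ
      homEquiv_naturality_left_symm := fun f g => by
        apply EquivariantModule.hom_ext
        refine Eq.trans ?_ ((Scheme.Modules.pullbackPushforwardAdjunction
          ξ.left).homEquiv_naturality_left_symm f (g ≫ invariantι ξ hξ _))
        exact congr_arg ((Scheme.Modules.pullbackPushforwardAdjunction ξ.left).homEquiv
          _ _).symm (Category.assoc f g (invariantι ξ hξ _))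
      homEquiv_naturality_right := fun {N M M'} f g => by
        apply invariant_hom_ext
        rw [invariantHomEquiv_ι, Category.assoc, invariantPushforward_map_ι, ← Category.assoc,
          invariantHomEquiv_ι]
        exact (Scheme.Modules.pullbackPushforwardAdjunction
          ξ.left).homEquiv_naturality_right f.hom g.hom }

/-- The morphism of `𝒪_Y`-modules `ξ^* (ξ_* M)^G ⟶ M` underlying the counit. -/
def invariantCounit (hξ : act G Y ≫ ξ = proj G Y ≫ ξ) (M : EquivariantModule G Y) :
    (Scheme.Modules.pullback ξ.left).obj ((invariantPushforward ξ hξ).obj M) ⟶ M.obj :=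
  EquivariantModule.Hom.hom ((invariantAdjunction ξ hξ).counit.app M)

/-- The counit `ξ^* (ξ_* M)^G ⟶ M` sends `ξ^* m` to `m`. -/
lemma unitSection_invariantCounit (hξ : act G Y ≫ ξ = proj G Y ≫ ξ) (M : EquivariantModule G Y)
    (U : X.left.Opens) :
    unitSection ξ.left ((invariantPushforward ξ hξ).obj M) U ≫
      (invariantCounit ξ hξ M).app (ξ.left ⁻¹ᵁ U) = (invariantι ξ hξ M).app U := by
  have h : (Scheme.Modules.pullbackPushforwardAdjunction ξ.left).homEquiv _ _
      (invariantCounit ξ hξ M) = invariantι ξ hξ M := by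
    refine (invariantHomEquiv_ι ξ hξ _ M ((invariantAdjunction ξ hξ).counit.app M)).symm.trans ?_
    have : invariantHomEquiv ξ hξ _ M ((invariantAdjunction ξ hξ).counit.app M) = 𝟙 _ :=
      (invariantHomEquiv ξ hξ _ M).apply_symm_apply _
    rw [this]
    exact Category.id_comp _
  rw [← h, Adjunction.homEquiv_unit]
  rfl

end Adjunction

/-! ### Sections of iterated pullbacks -/

section ResSection

variable {S T Z Y X : Scheme.{u}}

/-- For `f = b ∘ a`, the map `Γ(b^* M, O) ⟶ Γ(f^* M, O')` given by pullback of sections along `a`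
and the canonical isomorphism `a^* b^* M ≅ f^* M`. -/
def resSection (a : T ⟶ Z) (b : Z ⟶ Y) (f : T ⟶ Y) (hf : a ≫ b = f) (M : Y.Modules)
    (O : Z.Opens) (O' : T.Opens) (h : O' ≤ a ⁻¹ᵁ O) :
    Γ((Scheme.Modules.pullback b).obj M, O) ⟶ Γ((Scheme.Modules.pullback f).obj M, O') :=
  pullSection a _ O O' h ≫ ((pullbackComp' a b f hf).hom.app M).app O'

lemma pullSection_resSection (a : T ⟶ Z) (b : Z ⟶ Y) (f : T ⟶ Y) (hf : a ≫ b = f) (M : Y.Modules)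
    (O : Y.Opens) (O' : Z.Opens) (O'' : T.Opens) (h : O' ≤ b ⁻¹ᵁ O)
    (h' : O'' ≤ a ⁻¹ᵁ O') (h'' : O'' ≤ f ⁻¹ᵁ O) :
    pullSection b M O O' h ≫ resSection a b f hf M O' O'' h' = pullSection f M O O'' h'' :=
  pullSection_pullbackComp' a b f hf M O O' O'' h h' h''

/-- The coherence `pullbackComp'_assoc`, read on sections. -/
lemma resSection_resSection (a' : S ⟶ T) (a : T ⟶ Z) (b : Z ⟶ Y) (f : T ⟶ Y) (g : S ⟶ Y)
    (a'' : S ⟶ Z) (hf : a ≫ b = f) (hg : a' ≫ f = g) (ha : a' ≫ a = a'') (hg' : a'' ≫ b = g)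
    (M : Y.Modules) (O : Z.Opens) (O' : T.Opens) (O'' : S.Opens) (h : O' ≤ a ⁻¹ᵁ O)
    (h' : O'' ≤ a' ⁻¹ᵁ O') (h'' : O'' ≤ a'' ⁻¹ᵁ O) :
    resSection a b f hf M O O' h ≫ resSection a' f g hg M O' O'' h' =
      resSection a'' b g hg' M O O'' h'' := by
  have key := congr_arg (fun t => t.app O'')
    (pullbackComp'_assoc a' a b a'' f g ha hf hg hg' M)
  simp only [Scheme.Modules.Hom.comp_app] at key
  rw [resSection, resSection, resSection, Category.assoc, ← reassoc_of% pullSection_naturality, key,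
    ← pullSection_pullbackComp' a' a a'' ha _ O O' O'' h h' h'']
  simp only [Category.assoc]
  rfl

/-- Naturality of $a^*$ on sections; the canonical isomorphisms inside `baseChange` cancel. In this
form the cocycle condition can be applied to sections. -/
lemma resSection_baseChange {M : Y.Modules} {σ τ : Z ⟶ Y}
    (α : (Scheme.Modules.pullback σ).obj M ⟶ (Scheme.Modules.pullback τ).obj M)
    (a : T ⟶ Z) (f g : T ⟶ Y) (hf : a ≫ σ = f) (hg : a ≫ τ = g)
    (O : Z.Opens) (O' : T.Opens) (h : O' ≤ a ⁻¹ᵁ O) :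
    resSection a σ f hf M O O' h ≫ (baseChange α a f g hf hg).app O' =
      α.app O ≫ resSection a τ g hg M O O' h := by
  have e : ((pullbackComp' a σ f hf).hom.app M).app O' ≫
      ((pullbackComp' a σ f hf).inv.app M).app O' = 𝟙 _ := by
    rw [← Scheme.Modules.Hom.comp_app, Iso.hom_inv_id_app]; rfl
  rw [baseChange, Scheme.Modules.Hom.comp_app, Scheme.Modules.Hom.comp_app, resSection, resSection,
    Category.assoc, reassoc_of% e, reassoc_of% pullSection_naturality]

lemma isIso_resSection (a : T ⟶ Z) [IsOpenImmersion a] (b : Z ⟶ Y) (f : T ⟶ Y) (hf : a ≫ b = f)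
    (M : Y.Modules) (O : Z.Opens) (O' : T.Opens) (h : O' ≤ a ⁻¹ᵁ O) (h' : O' = a ⁻¹ᵁ O)
    (hO : O ≤ a.opensRange) : IsIso (resSection a b f hf M O O' h) := by
  have := isIso_pullSection a ((Scheme.Modules.pullback b).obj M) O O' h h' hO
  rw [resSection]
  infer_instance

instance isIso_baseChange {M : Y.Modules} {σ τ : Z ⟶ Y}
    (α : (Scheme.Modules.pullback σ).obj M ⟶ (Scheme.Modules.pullback τ).obj M) [IsIso α]
    (a : T ⟶ Z) (f g : T ⟶ Y) (hf : a ≫ σ = f) (hg : a ≫ τ = g) :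
    IsIso (baseChange α a f g hf hg) := by
  rw [baseChange]
  infer_instance

/-- Coherence at the source and at the target, joined by naturality of $b^*a^*\cong c^*$ at
$\alpha$. It allows the cocycle identity to be pulled back to any point of $G\times G\times Y$. -/
lemma baseChange_baseChange {M : Y.Modules} {σ τ : Z ⟶ Y}
    (α : (Scheme.Modules.pullback σ).obj M ⟶ (Scheme.Modules.pullback τ).obj M)
    (a : T ⟶ Z) (f g : T ⟶ Y) (hf : a ≫ σ = f) (hg : a ≫ τ = g)
    (b : S ⟶ T) (c : S ⟶ Z) (hc : b ≫ a = c) (f' g' : S ⟶ Y) (hf' : b ≫ f = f')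
    (hg' : b ≫ g = g') (hf'' : c ≫ σ = f') (hg'' : c ≫ τ = g') :
    baseChange (baseChange α a f g hf hg) b f' g' hf' hg' = baseChange α c f' g' hf'' hg'' := by
  have h1 := pullbackComp'_assoc b a σ c f f' hc hf hf' hf'' M
  have h2 := pullbackComp'_assoc b a τ c g g' hc hg hg' hg'' M
  have h3 := (pullbackComp' b a c hc).hom.naturality α
  have h4 : (pullbackComp' b f f' hf').inv.app M ≫
      (Scheme.Modules.pullback b).map ((pullbackComp' a σ f hf).inv.app M) =
      (pullbackComp' c σ f' hf'').inv.app M ≫ (pullbackComp' b a c hc).inv.app _ := by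
    rw [← cancel_epi ((pullbackComp' c σ f' hf'').hom.app M),
      ← cancel_epi ((pullbackComp' b a c hc).hom.app _), ← reassoc_of% h1]
    simp only [Iso.hom_inv_id_app_assoc]
    erw [Iso.hom_inv_id_app]
    rw [← Functor.map_comp, Iso.hom_inv_id_app]
    simp
  simp only [baseChange, Functor.map_comp, Category.assoc, h2]
  rw [reassoc_of% h4]
  simp only [Functor.comp_map] at h3
  rw [reassoc_of% h3]
  simp

lemma baseChange_comp {M : Y.Modules} {σ τ ρ : Z ⟶ Y}
    (α : (Scheme.Modules.pullback σ).obj M ⟶ (Scheme.Modules.pullback τ).obj M)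
    (β : (Scheme.Modules.pullback τ).obj M ⟶ (Scheme.Modules.pullback ρ).obj M)
    (a : T ⟶ Z) (f g h : T ⟶ Y) (hf : a ≫ σ = f) (hg : a ≫ τ = g) (hh : a ≫ ρ = h) :
    baseChange (α ≫ β) a f h hf hh = baseChange α a f g hf hg ≫ baseChange β a g h hg hh := by
  simp only [baseChange, Functor.map_comp, Category.assoc, Iso.hom_inv_id_app_assoc]

end ResSection

/-! ### Descent along a morphism with local sections -/

/-- A criterion for a comparison morphism from an equalizer to be an isomorphism. -/
lemma isIso_comp_of_isLimit_fork {C : Type*} [Category* C] {E M Z W V K : C} {c : E ⟶ M}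
    {D P : M ⟶ Z} {w : c ≫ D = c ≫ P} (hc : Limits.IsLimit (Limits.Fork.ofι c w))
    (S : M ⟶ W) (A : M ⟶ V) (B : W ⟶ V) (T : Z ⟶ V) (Q : Z ⟶ K) (Cσ Cτ : V ⟶ K)
    [IsIso A] [Mono B] [Mono Q] (hDT : D ≫ T = A) (hPT : P ≫ T = S ≫ B)
    (hDQ : D ≫ Q = A ≫ Cσ) (hPQ : P ≫ Q = A ≫ Cτ) (hBC : B ≫ Cσ = B ≫ Cτ) :
    IsIso (c ≫ S) := by
  -- The candidate inverse is $A^{-1}B$ (apply $B$ first). It lands in the equalizer because $Q$,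
  -- being mono, lets $D=P$ be tested after $Q$, where it becomes `hBC`.
  have hl : (B ≫ inv A) ≫ D = (B ≫ inv A) ≫ P := by
    rw [← cancel_mono Q]
    simp only [Category.assoc, hDQ, hPQ, IsIso.inv_hom_id_assoc, hBC]
  obtain ⟨l, hl'⟩ := Limits.Fork.IsLimit.lift' hc (B ≫ inv A) hl
  rw [Limits.Fork.ι_ofι] at hl'
  have : Mono c := Limits.mono_of_isLimit_fork hc
  have hw : c ≫ S ≫ B = c ≫ A := by rw [← hPT, ← hDT, reassoc_of% w]
  refine ⟨l, ?_, ?_⟩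
  · rw [← cancel_mono c, Category.assoc, hl', ← Category.assoc (c ≫ S), Category.assoc c, hw]
    simp
  · rw [← cancel_mono B]
    rw [Category.assoc, Category.assoc, reassoc_of% hl']
    rw [← hPT, ← reassoc_of% hl, hDT]
    simp

section LocalSplitting

variable {Z Y X : Scheme.{u}}

/-- A section `s` of `ξ : Y ⟶ X` over an open subscheme `W` of `X`, for a groupoid
`σ, τ : Z ⟶ Y` over `X`, with a morphism `t : ξ⁻¹(W) ⟶ Z` connecting `y` to `s (ξ y)`. -/
structure LocalSplitting (ξ : Y ⟶ X) (σ τ : Z ⟶ Y) where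
  /-- the open subscheme of `X` -/
  W : Scheme.{u}
  /-- its preimage in `Y` -/
  V : Scheme.{u}
  /-- its preimage in `Z` -/
  K : Scheme.{u}
  /-- the inclusion of `W` -/
  i : W ⟶ X
  /-- the inclusion of `V` -/
  j : V ⟶ Y
  /-- the inclusion of `K` -/
  k : K ⟶ Z
  /-- the restriction of `ξ` -/
  ξV : V ⟶ W
  /-- the restriction of `σ` -/
  σV : K ⟶ V
  /-- the restriction of `τ` -/
  τV : K ⟶ V
  /-- the section -/
  s : W ⟶ Y
  /-- the section as a morphism to `V` -/
  sV : W ⟶ V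
  /-- the morphism connecting `y` to `s (ξ y)` -/
  t : V ⟶ Z
  [isOpenImmersion_i : IsOpenImmersion i]
  [isOpenImmersion_j : IsOpenImmersion j]
  [isOpenImmersion_k : IsOpenImmersion k]
  ξV_i : ξV ≫ i = j ≫ ξ
  σV_j : σV ≫ j = k ≫ σ
  τV_j : τV ≫ j = k ≫ τ
  σV_ξV : σV ≫ ξV = τV ≫ ξV
  sV_j : sV ≫ j = s
  s_ξ : s ≫ ξ = i
  sV_ξV : sV ≫ ξV = 𝟙 W
  t_σ : t ≫ σ = j
  t_τ : t ≫ τ = ξV ≫ s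
  preimage_le_j : ξ ⁻¹ᵁ i.opensRange ≤ j.opensRange
  preimage_le_k : σ ⁻¹ᵁ ξ ⁻¹ᵁ i.opensRange ≤ k.opensRange

attribute [instance] LocalSplitting.isOpenImmersion_i LocalSplitting.isOpenImmersion_j
  LocalSplitting.isOpenImmersion_k

namespace LocalSplitting

variable {ξ : Y ⟶ X} {σ τ : Z ⟶ Y} (L : LocalSplitting ξ σ τ)

/-- For an arrow $z$ with $\sigma z=y$ and $\tau z=y'$, the arrows $t(y)$ and $t(y')$ share the
endpoint $s(\xi y)=s(\xi y')$. These four identities are what `Cocycle` needs in order to be stated.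
-/
lemma σV_t_σ : (L.σV ≫ L.t) ≫ σ = L.k ≫ σ := by rw [Category.assoc, L.t_σ, L.σV_j]

lemma σV_t_τ : (L.σV ≫ L.t) ≫ τ = L.σV ≫ L.ξV ≫ L.s := by rw [Category.assoc, L.t_τ]

lemma τV_t_σ : (L.τV ≫ L.t) ≫ σ = L.k ≫ τ := by rw [Category.assoc, L.t_σ, L.τV_j]

lemma τV_t_τ : (L.τV ≫ L.t) ≫ τ = L.σV ≫ L.ξV ≫ L.s := by
  rw [Category.assoc, L.t_τ, ← Category.assoc, ← L.σV_ξV, Category.assoc]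

/-- Compatibility of `α : σ^* M ⟶ τ^* M` with the composition of the arrows `y ⟵ z` and
`z ⟵ s (ξ z)` of the groupoid. -/
def Cocycle {M : Y.Modules}
    (α : (Scheme.Modules.pullback σ).obj M ⟶ (Scheme.Modules.pullback τ).obj M) : Prop :=
  baseChange α (L.σV ≫ L.t) (L.k ≫ σ) (L.σV ≫ L.ξV ≫ L.s) L.σV_t_σ L.σV_t_τ =
    baseChange α L.k (L.k ≫ σ) (L.k ≫ τ) rfl rfl ≫
      baseChange α (L.τV ≫ L.t) (L.k ≫ τ) (L.σV ≫ L.ξV ≫ L.s) L.τV_t_σ L.τV_t_τ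

lemma le_s (U : X.Opens) : L.i ⁻¹ᵁ U ≤ L.s ⁻¹ᵁ ξ ⁻¹ᵁ U := by
  rw [← L.s_ξ]; exact le_rfl

lemma le_ξV (U : X.Opens) : L.j ⁻¹ᵁ ξ ⁻¹ᵁ U ≤ L.ξV ⁻¹ᵁ L.i ⁻¹ᵁ U := by
  rw [← Scheme.Hom.comp_preimage, ← Scheme.Hom.comp_preimage, L.ξV_i]

lemma le_sV (U : X.Opens) : L.i ⁻¹ᵁ U ≤ L.sV ⁻¹ᵁ L.j ⁻¹ᵁ ξ ⁻¹ᵁ U := by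
  rw [← Scheme.Hom.comp_preimage L.sV, L.sV_j]; exact L.le_s U

lemma le_t (O : Y.Opens) (O' : Z.Opens) (h : O' = σ ⁻¹ᵁ O) : L.j ⁻¹ᵁ O ≤ L.t ⁻¹ᵁ O' := by
  rw [h, ← Scheme.Hom.comp_preimage L.t, L.t_σ]

lemma le_σV (O : Y.Opens) (O' : Z.Opens) (h : O' = σ ⁻¹ᵁ O) :
    L.k ⁻¹ᵁ O' ≤ L.σV ⁻¹ᵁ L.j ⁻¹ᵁ O := by
  rw [h, ← Scheme.Hom.comp_preimage, ← Scheme.Hom.comp_preimage L.σV, L.σV_j]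

lemma le_τV (O : Y.Opens) (O' : Z.Opens) (h : O' = τ ⁻¹ᵁ O) :
    L.k ⁻¹ᵁ O' ≤ L.τV ⁻¹ᵁ L.j ⁻¹ᵁ O := by
  rw [h, ← Scheme.Hom.comp_preimage, ← Scheme.Hom.comp_preimage L.τV, L.τV_j]

/-- If `α` satisfies the cocycle condition, then `s^*` identifies the sections `m` of `M` over
`ξ⁻¹(U)` with `α (σ^* m) = τ^* m` with the sections of `s^* M` over `U`. -/
theorem isIso_comp_pullSection {M : Y.Modules}
    (α : (Scheme.Modules.pullback σ).obj M ⟶ (Scheme.Modules.pullback τ).obj M) [IsIso α]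
    (hα : L.Cocycle α) (U : X.Opens) (hU : U ≤ L.i.opensRange) (O : Z.Opens)
    (hσ : O = σ ⁻¹ᵁ ξ ⁻¹ᵁ U) (hτ : O = τ ⁻¹ᵁ ξ ⁻¹ᵁ U) {E : Ab} (c : E ⟶ Γ(M, ξ ⁻¹ᵁ U))
    (w : c ≫ pullSection σ M (ξ ⁻¹ᵁ U) O hσ.le ≫ α.app O =
      c ≫ pullSection τ M (ξ ⁻¹ᵁ U) O hτ.le)
    (hc : Limits.IsLimit (Limits.Fork.ofι c w)) :
    IsIso (c ≫ pullSection L.s M (ξ ⁻¹ᵁ U) (L.i ⁻¹ᵁ U) (L.le_s U)) := by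
  have hξU : L.j ⁻¹ᵁ ξ ⁻¹ᵁ U ≤ (L.ξV ≫ L.s) ⁻¹ᵁ ξ ⁻¹ᵁ U :=
    (L.le_ξV U).trans (L.ξV.preimage_mono (L.le_s U))
  have hqU : L.k ⁻¹ᵁ O ≤ (L.σV ≫ L.ξV) ⁻¹ᵁ L.i ⁻¹ᵁ U :=
    (L.le_σV _ O hσ).trans (L.σV.preimage_mono (L.le_ξV U))
  have hkσ : L.k ⁻¹ᵁ O ≤ (L.k ≫ σ) ⁻¹ᵁ ξ ⁻¹ᵁ U := by rw [hσ]; exact le_rfl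
  have hkτ : L.k ⁻¹ᵁ O ≤ (L.k ≫ τ) ⁻¹ᵁ ξ ⁻¹ᵁ U := by rw [hτ]; exact le_rfl
  have hσt : L.k ⁻¹ᵁ O ≤ (L.σV ≫ L.t) ⁻¹ᵁ O :=
    (L.le_σV _ O hσ).trans (L.σV.preimage_mono (L.le_t _ O hσ))
  have hτt : L.k ⁻¹ᵁ O ≤ (L.τV ≫ L.t) ⁻¹ᵁ O :=
    (L.le_τV _ O hτ).trans (L.τV.preimage_mono (L.le_t _ O hσ))
  -- In the notation of `isIso_comp_of_isLimit_fork`: $D$ and $P$ are the two sides of the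
  -- invariance equation, $S=s^*$, $A=\alpha_t$, $B=\xi^*$ on sections of $s^*M$, $T=t^*$, and $Q$
  -- is restriction to $K$ followed by the pullback of $\alpha$ along $t\circ\tau$. $C_\sigma$ and
  -- $C_\tau$ are pullbacks along the two maps $K\to V$.
  let D := pullSection σ M (ξ ⁻¹ᵁ U) O hσ.le ≫ α.app O
  let P := pullSection τ M (ξ ⁻¹ᵁ U) O hτ.le
  let S := pullSection L.s M (ξ ⁻¹ᵁ U) (L.i ⁻¹ᵁ U) (L.le_s U)
  let A := pullSection L.j M (ξ ⁻¹ᵁ U) (L.j ⁻¹ᵁ ξ ⁻¹ᵁ U) le_rfl ≫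
    (baseChange α L.t L.j (L.ξV ≫ L.s) L.t_σ L.t_τ).app _
  let B := resSection L.ξV L.s (L.ξV ≫ L.s) rfl M (L.i ⁻¹ᵁ U) (L.j ⁻¹ᵁ ξ ⁻¹ᵁ U) (L.le_ξV U)
  let T := resSection L.t τ (L.ξV ≫ L.s) L.t_τ M O (L.j ⁻¹ᵁ ξ ⁻¹ᵁ U) (L.le_t _ O hσ)
  let Q := resSection L.k τ (L.k ≫ τ) rfl M O (L.k ⁻¹ᵁ O) le_rfl ≫
    (baseChange α (L.τV ≫ L.t) (L.k ≫ τ) (L.σV ≫ L.ξV ≫ L.s) L.τV_t_σ L.τV_t_τ).app _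
  let Cσ := resSection L.σV (L.ξV ≫ L.s) (L.σV ≫ L.ξV ≫ L.s) rfl M (L.j ⁻¹ᵁ ξ ⁻¹ᵁ U)
    (L.k ⁻¹ᵁ O) (L.le_σV _ O hσ)
  let Cτ := resSection L.τV (L.ξV ≫ L.s) (L.σV ≫ L.ξV ≫ L.s)
    (by rw [← Category.assoc, ← L.σV_ξV, Category.assoc]) M (L.j ⁻¹ᵁ ξ ⁻¹ᵁ U)
    (L.k ⁻¹ᵁ O) (L.le_τV _ O hτ)
  have hA : IsIso A := by
    have := isIso_pullSection L.j M (ξ ⁻¹ᵁ U) _ le_rfl rfl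
      ((ξ.preimage_mono hU).trans L.preimage_le_j)
    infer_instance
  have hQ : IsIso Q := by
    have := isIso_resSection L.k τ (L.k ≫ τ) rfl M O _ le_rfl rfl (by
      rw [hσ]; exact ((σ.preimage_mono (ξ.preimage_mono hU)).trans L.preimage_le_k))
    infer_instance
  -- Since `sV` is a section of `ξV`, pullback along it is a left inverse of $B$, up to the
  -- isomorphism for the identity of $W$.
  have hB : Mono B := by
    have := isIso_resSection (𝟙 L.W) L.s L.s (Category.id_comp _) M (L.i ⁻¹ᵁ U) (L.i ⁻¹ᵁ U)
      le_rfl rfl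
      (by rw [Scheme.Hom.opensRange_of_isIso]; exact le_top)
    have h := resSection_resSection L.sV L.ξV L.s (L.ξV ≫ L.s) L.s (𝟙 _) rfl
      (by rw [← Category.assoc, L.sV_ξV, Category.id_comp]) L.sV_ξV (Category.id_comp _) M
      (L.i ⁻¹ᵁ U) (L.j ⁻¹ᵁ ξ ⁻¹ᵁ U) (L.i ⁻¹ᵁ U) (L.le_ξV U) (L.le_sV U) le_rfl
    rw [← h] at this
    exact mono_of_mono B (resSection L.sV (L.ξV ≫ L.s) L.s _ M _ _ (L.le_sV U))
  have hAT : A = D ≫ T := by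
    dsimp only [A, D, T]
    rw [Category.assoc, ← resSection_baseChange α L.t L.j _ L.t_σ,
      reassoc_of% pullSection_resSection]
  have hPT : P ≫ T = S ≫ B := by
    dsimp only [P, T, S, B]
    rw [pullSection_resSection _ _ _ _ _ _ _ _ _ _ hξU,
      pullSection_resSection _ _ _ _ _ _ _ _ _ _ hξU]
  have hDQ : D ≫ Q = A ≫ Cσ := by
    rw [hAT]
    dsimp only [D, Q, T, Cσ]
    rw [Category.assoc, Category.assoc, Category.assoc,
      resSection_resSection _ _ _ _ _ (L.σV ≫ L.t) _ _ rfl L.σV_t_τ _ _ _ _ _ _ hσt,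
      ← reassoc_of% resSection_baseChange α L.k (L.k ≫ σ) (L.k ≫ τ) rfl rfl O _ le_rfl,
      ← Scheme.Modules.Hom.comp_app]
    -- Only here does the cocycle condition enter: the two successive uses of $\alpha$ merge into
    -- its pullback along $t\circ\sigma$.
    have hα' := hα
    rw [Cocycle] at hα'
    rw [← hα', reassoc_of% pullSection_resSection _ _ _ _ _ _ _ _ _ _ hkσ,
      ← resSection_baseChange α (L.σV ≫ L.t) (L.k ≫ σ) _ L.σV_t_σ,
      reassoc_of% pullSection_resSection _ _ _ _ _ _ _ _ _ _ hkσ]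
  have hPQ : P ≫ Q = A ≫ Cτ := by
    rw [hAT]
    dsimp only [P, Q, D, T, Cτ]
    rw [Category.assoc, Category.assoc,
      resSection_resSection _ _ _ _ _ (L.τV ≫ L.t) _ _ rfl L.τV_t_τ _ _ _ _ _ _ hτt,
      ← resSection_baseChange α (L.τV ≫ L.t) (L.k ≫ τ) _ L.τV_t_σ,
      reassoc_of% pullSection_resSection _ _ _ _ _ _ _ _ _ _ hkτ,
      reassoc_of% pullSection_resSection _ _ _ _ _ _ _ _ _ _ hkτ]
  have hBC : B ≫ Cσ = B ≫ Cτ := by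
    dsimp only [B, Cσ, Cτ]
    rw [resSection_resSection _ _ _ _ _ (L.σV ≫ L.ξV) _ _ rfl (Category.assoc _ _ _)
        _ _ _ _ _ _ hqU,
      resSection_resSection _ _ _ _ _ (L.σV ≫ L.ξV) _ _ L.σV_ξV.symm (Category.assoc _ _ _)
        _ _ _ _ _ _ hqU]
  exact isIso_comp_of_isLimit_fork hc S A B T Q Cσ Cτ hAT.symm hPT hDQ hPQ hBC

end LocalSplitting
end LocalSplitting

/-! ### Local properties of modules -/

section Local

variable {T Y X : Scheme.{u}}

/-- Being an isomorphism can be checked after pullback to an open cover. -/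
lemma isIso_of_isIso_pullback {M N : X.Modules} (φ : M ⟶ N)
    (h : ∀ x : X, ∃ (W : Scheme.{u}) (i : W ⟶ X) (_ : IsOpenImmersion i), x ∈ i.opensRange ∧
      IsIso ((Scheme.Modules.pullback i).map φ)) : IsIso φ := by
  choose W i hi hx hφ using h
  let F : TopCat.Sheaf Ab X := ⟨M.presheaf, M.isSheaf⟩
  let F' : TopCat.Sheaf Ab X := ⟨N.presheaf, N.isSheaf⟩
  let ψ : F ⟶ F' := ⟨φ.mapPresheaf⟩
  -- Opens lying inside one member of the cover form a basis, and on them sections agree with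
  -- sections of the pullback.
  let B : { U : X.Opens // ∃ x, U ≤ (i x).opensRange } → X.Opens := Subtype.val
  have hB : TopologicalSpace.Opens.IsBasis (Set.range B) := by
    rw [TopologicalSpace.Opens.isBasis_iff_nbhd]
    intro U x hxU
    exact ⟨U ⊓ (i x).opensRange, ⟨⟨_, x, inf_le_right⟩, rfl⟩, ⟨hxU, hx x⟩, inf_le_left⟩
  have hψ : IsIso ψ := by
    refine TopCat.Sheaf.isIso_iff_isIso_basis hB fun U => ?_
    obtain ⟨U, x, hU⟩ := U
    change IsIso (φ.app U)
    have h1 := isIso_pullSection (i x) M U _ le_rfl rfl hU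
    have h2 := isIso_pullSection (i x) N U _ le_rfl rfl hU
    have h3 := pullSection_naturality (i x) φ U _ le_rfl
    have h4 : IsIso (((Scheme.Modules.pullback (i x)).map φ).app (i x ⁻¹ᵁ U)) := inferInstance
    have h5 : IsIso (φ.app U ≫ pullSection (i x) N U _ le_rfl) := h3 ▸ inferInstance
    exact IsIso.of_isIso_comp_right _ (pullSection (i x) N U _ le_rfl)
  rw [Scheme.Modules.Hom.isIso_iff_isIso_app]
  intro U
  exact ((Functor.mapIso (sheafToPresheaf _ _) (@asIso _ _ _ _ ψ hψ)).app (Opposite.op U)).isIso_hom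

/-- Transport of a presentation along an isomorphism of `𝒪_X`-modules. -/
def presentationOfIso {M N : X.Modules} (e : M ≅ N) (P : M.Presentation) : N.Presentation :=
  have : IsIso (C := SheafOfModules.{u} X.ringCatSheaf) e.hom := (inferInstance : IsIso e.hom)
  SheafOfModules.Presentation.ofIsIso.{u, u, u} (R := X.ringCatSheaf) (M := M) (N := N) e.hom P

/-- A presentation of the restriction of `M` to an open subscheme `U`, as a presentation of the
restriction of `M` to the slice site. -/
def presentationOver (M : X.Modules) (U : X.Opens) (P : (M.restrict U.ι).Presentation) :
    SheafOfModules.Presentation.{u, u, u} (SheafOfModules.over M U) :=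
  SheafOfModules.Presentation.ofIsIso.{u, u, u}
    ((U.sheafOfModulesEquivOver X.ringCatSheaf).unitIso.app (SheafOfModules.over M U)).inv
    (SheafOfModules.Presentation.map.{u, u, u} (R := U.sheafRestrict.obj X.ringCatSheaf)
      (presentationOfIso ((Scheme.Modules.overFunctorEquiv U).app M).symm P)
      (U.sheafOfModulesEquivOver X.ringCatSheaf).inverse
      (U.sheafOfModulesEquivOverInverseUnit X.ringCatSheaf).symm)

/-- A module with presentations on an open cover is quasi-coherent. -/
lemma isQuasicoherent_of_presentation (M : X.Modules)
    (h : ∀ x : X, ∃ (W : Scheme.{u}) (i : W ⟶ X) (_ : IsOpenImmersion i), x ∈ i.opensRange ∧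
      Nonempty (M.restrict i).Presentation) : M.IsQuasicoherent := by
  have h' : ∀ x : X, ∃ U : X.Opens, x ∈ U ∧ Nonempty (M.restrict U.ι).Presentation := by
    intro x
    obtain ⟨W, i, hi, hx, ⟨P⟩⟩ := h x
    refine ⟨i.opensRange, hx, ⟨?_⟩⟩
    have e : i.opensRange.ι = i.isoOpensRange.inv ≫ i := by simp
    exact presentationOfIso ((Scheme.Modules.restrictFunctorComp _ _).symm.app M ≪≫
        (Scheme.Modules.restrictFunctorCongr e.symm).app M)
      (Scheme.Modules.presentationRestrict i.isoOpensRange.inv P)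
  choose U hU P using h'
  refine SheafOfModules.QuasicoherentData.isQuasicoherent.{u, u} (M := M) (q :=
    { I := X
      X := U
      coversTop := ?_
      presentation := fun x => presentationOver M (U x) (P x).some })
  rw [Opens.coversTop_iff, TopologicalSpace.IsOpenCover, eq_top_iff]
  intro x _
  exact TopologicalSpace.Opens.mem_iSup.2 ⟨x, hU x⟩

/-- The pullback of the structure sheaf is the structure sheaf. -/
def pullbackUnitIso (f : T ⟶ Y) :
    (Scheme.Modules.pullback f).obj (SheafOfModules.unit Y.ringCatSheaf) ≅
      SheafOfModules.unit T.ringCatSheaf := by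
  -- The comparison $f^*\mathcal O_Y\to\mathcal O_T$ is invertible once the preimage functor on
  -- opens is final. That holds because $\top$ is terminal on both sides and $f^{-1}(\top)=\top$.
  have h1 : (Functor.fromPUnit.{0} (⊤ : Y.Opens)).Final :=
    Functor.final_fromPUnit_of_isTerminal Limits.isTerminalTop
  have h2 : (Functor.fromPUnit.{0} (⊤ : T.Opens)).Final :=
    Functor.final_fromPUnit_of_isTerminal Limits.isTerminalTop
  have h3 : (Functor.fromPUnit.{0} (⊤ : Y.Opens) ⋙ TopologicalSpace.Opens.map f.base).Final :=
    Functor.final_of_natIso (F := Functor.fromPUnit.{0} (⊤ : T.Opens))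
      (Discrete.natIso fun _ => Iso.refl _)
  have h4 : (TopologicalSpace.Opens.map f.base).Final :=
    Functor.final_of_final_comp (Functor.fromPUnit.{0} (⊤ : Y.Opens)) _
  have h5 : (SheafOfModules.pushforward.{u} f.toRingCatSheafHom).IsRightAdjoint :=
    (Scheme.Modules.pullbackPushforwardAdjunction f).isRightAdjoint
  let φ : (SheafOfModules.pullback.{u} f.toRingCatSheafHom).obj (SheafOfModules.unit Y.ringCatSheaf) ⟶
      SheafOfModules.unit T.ringCatSheaf :=
    SheafOfModules.pullbackObjUnitToUnit f.toRingCatSheafHom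
  have h6 : IsIso φ := SheafOfModules.instIsIsoPullbackObjUnitToUnitOfFinal f.toRingCatSheafHom
  have e := asIso φ
  exact ⟨e.hom, e.inv, e.3, e.4⟩

/-- The pullback of a presentation. -/
def presentationPullback (f : T ⟶ Y) {N : Y.Modules} (P : N.Presentation) :
    ((Scheme.Modules.pullback f).obj N).Presentation :=
  let F : SheafOfModules.{u} Y.ringCatSheaf ⥤ SheafOfModules.{u} T.ringCatSheaf :=
    Scheme.Modules.pullback f
  have : Limits.PreservesColimitsOfSize.{u, u} F :=
    (Scheme.Modules.pullbackPushforwardAdjunction f).leftAdjoint_preservesColimits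
  SheafOfModules.Presentation.map.{u, u, u} P F
    ⟨(pullbackUnitIso f).inv, (pullbackUnitIso f).hom, (pullbackUnitIso f).4, (pullbackUnitIso f).3⟩

/-- The pullback of a quasi-coherent module is quasi-coherent. -/
lemma isQCoh_pullback (f : T ⟶ Y) {N : Y.Modules} (hN : isQCoh Y N) :
    isQCoh T ((Scheme.Modules.pullback f).obj N) := by
  have : N.IsQuasicoherent := hN
  obtain ⟨I, U, P, hU, -⟩ := N.exists_isOpenCover_presentation
  refine isQuasicoherent_of_presentation _ fun x => ?_
  obtain ⟨i, hi⟩ : ∃ i, f x ∈ U i := by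
    have : f x ∈ iSup U := by rw [hU.iSup_eq_top]; trivial
    exact TopologicalSpace.Opens.mem_iSup.1 this
  refine ⟨_, (f ⁻¹ᵁ U i).ι, inferInstance, by simpa using hi, ⟨?_⟩⟩
  refine presentationOfIso ?_ (presentationPullback (f ∣_ U i) (P i))
  exact (Scheme.Modules.pullback (f ∣_ U i)).mapIso
      ((Scheme.Modules.restrictFunctorIsoPullback (U i).ι).app N) ≪≫
    (pullbackComp' (f ∣_ U i) (U i).ι ((f ⁻¹ᵁ U i).ι ≫ f) (morphismRestrict_ι f (U i))).app N ≪≫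
    ((pullbackComp' (f ⁻¹ᵁ U i).ι f _ rfl).app N).symm ≪≫
    ((Scheme.Modules.restrictFunctorIsoPullback (f ⁻¹ᵁ U i).ι).app _).symm

lemma isQCoh_of_iso {M N : X.Modules} (e : M ≅ N) (h : isQCoh X M) : isQCoh X N := by
  have e' : @Iso (SheafOfModules.{u} X.ringCatSheaf) _ M N := ⟨e.hom, e.inv, e.3, e.4⟩
  exact (SheafOfModules.isQuasicoherent X.ringCatSheaf).prop_of_iso e' h

/-- Quasi-coherence can be checked after pullback to an open cover. -/
lemma isQCoh_of_isQCoh_pullback (M : X.Modules)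
    (h : ∀ x : X, ∃ (W : Scheme.{u}) (i : W ⟶ X) (_ : IsOpenImmersion i), x ∈ i.opensRange ∧
      isQCoh W ((Scheme.Modules.pullback i).obj M)) : isQCoh X M := by
  refine isQuasicoherent_of_presentation _ fun x => ?_
  obtain ⟨W, i, hi, ⟨w, rfl⟩, hM⟩ := h x
  have : (M.restrict i).IsQuasicoherent :=
    isQCoh_of_iso ((Scheme.Modules.restrictFunctorIsoPullback i).app M).symm hM
  obtain ⟨I, U, P, hU, -⟩ := (M.restrict i).exists_isOpenCover_presentation
  obtain ⟨a, ha⟩ : ∃ a, w ∈ U a := by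
    have : w ∈ iSup U := by rw [hU.iSup_eq_top]; trivial
    exact TopologicalSpace.Opens.mem_iSup.1 this
  refine ⟨_, (U a).ι ≫ i, inferInstance, ⟨⟨w, ha⟩, rfl⟩, ⟨?_⟩⟩
  exact presentationOfIso ((Scheme.Modules.restrictFunctorComp _ _).symm.app M) (P a)

end Local

/-! ### Local sections of locally trivial torsors -/

section TorsorSections

variable {R : Type u} [CommRing R] {G Y X : Over (Spec (CommRingCat.of R))} [GrpObj G]

instance mono_openOverι {Z : Over (Spec (CommRingCat.of R))} (U : Z.left.Opens) :
    Mono (openOverι U) :=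
  have : Mono (openOverι U).left := (inferInstance : Mono U.ι)
  Over.mono_of_mono_left _

/-- A morphism with image in an open subscheme factors through it. -/
lemma exists_lift_openOverι {T Z : Over (Spec (CommRingCat.of R))} (U : Z.left.Opens) (f : T ⟶ Z)
    (h : ∀ x, f.left x ∈ U) : ∃ g : T ⟶ openOver U, g ≫ openOverι U = f := by
  have h' : Set.range f.left ⊆ Set.range U.ι := by
    rintro _ ⟨x, rfl⟩
    rw [Scheme.Opens.range_ι]
    exact h x
  refine ⟨Over.homMk (IsOpenImmersion.lift U.ι f.left h') ?_, ?_⟩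
  · exact (IsOpenImmersion.lift_fac_assoc U.ι f.left h' Z.hom).trans (Over.w f)
  · ext1
    exact IsOpenImmersion.lift_fac U.ι f.left h'

/-- The restriction `ξ⁻¹(U) ⟶ U` of `ξ`. -/
def restrictOver (ξ : Y ⟶ X) (U : X.left.Opens) : openOver (ξ.left ⁻¹ᵁ U) ⟶ openOver U :=
  Over.homMk (ξ.left ∣_ U) (by
    have := Over.w ξ
    simp only [openOver, Over.mk_hom, morphismRestrict_ι_assoc]
    rw [this])

lemma restrictOver_ι (ξ : Y ⟶ X) (U : X.left.Opens) :
    restrictOver ξ U ≫ openOverι U = openOverι (ξ.left ⁻¹ᵁ U) ≫ ξ := by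
  ext1
  exact morphismRestrict_ι ξ.left U

lemma lift_mulMap {T : Over (Spec (CommRingCat.of R))} (g h : T ⟶ G) (y : T ⟶ Y) :
    lift g (lift h y) ≫ mulMap G Y = lift (lift g h ≫ μ[G]) y := by
  ext1 <;> simp [mulMap]

variable [ModObj G Y]

/-- Surjectivity of $G\times Y\to Y\times_XY$ on $T$-points: the action is transitive on fibres.
`IsTorsor.hom_ext` is the injectivity. -/
lemma IsTorsor.exists_lift {ξ : Y ⟶ X} (hξ : IsTorsor G ξ) {T : Over (Spec (CommRingCat.of R))}
    (y y' : T ⟶ Y) (h : y ≫ ξ = y' ≫ ξ) : ∃ z : T ⟶ G ⊗ Y, z ≫ act G Y = y ∧ z ≫ proj G Y = y' := by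
  have h1 := Limits.pullback.lift_fst (act G Y) (proj G Y) hξ.invariant
  have h2 := Limits.pullback.lift_snd (act G Y) (proj G Y) hξ.invariant
  have := hξ.isIso
  generalize Limits.pullback.lift (act G Y) (proj G Y) hξ.invariant = φ at h1 h2 this
  refine ⟨Limits.pullback.lift y y' h ≫ inv φ, ?_, ?_⟩
  · rw [← h1, Category.assoc, IsIso.inv_hom_id_assoc, Limits.pullback.lift_fst]
  · rw [← h2, Category.assoc, IsIso.inv_hom_id_assoc, Limits.pullback.lift_snd]

lemma IsTorsor.hom_ext {ξ : Y ⟶ X} (hξ : IsTorsor G ξ) {T : Over (Spec (CommRingCat.of R))}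
    {z z' : T ⟶ G ⊗ Y} (h : z ≫ act G Y = z' ≫ act G Y) (h' : z ≫ proj G Y = z' ≫ proj G Y) :
    z = z' := by
  have h1 := Limits.pullback.lift_fst (act G Y) (proj G Y) hξ.invariant
  have h2 := Limits.pullback.lift_snd (act G Y) (proj G Y) hξ.invariant
  have := hξ.isIso
  generalize Limits.pullback.lift (act G Y) (proj G Y) hξ.invariant = φ at h1 h2 this
  rw [← h1, ← Category.assoc, ← Category.assoc] at h
  rw [← h2, ← Category.assoc, ← Category.assoc] at h'
  rw [← cancel_mono φ]
  exact Limits.pullback.hom_ext h h'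

/-- A morphism from `ξ⁻¹(U)` that is constant on the fibres of `ξ` factors through `U`. -/
lemma IsTorsor.exists_desc {ξ : Y ⟶ X} (hξ : IsTorsor G ξ) (U : X.left.Opens)
    (hU : IsAffineOpen U) (hV : IsAffineOpen (ξ.left ⁻¹ᵁ U)) {Q : Over (Spec (CommRingCat.of R))}
    (π : openOver (ξ.left ⁻¹ᵁ U) ⟶ Q)
    (h : ∀ (T : Over (Spec (CommRingCat.of R))) (a b : T ⟶ openOver (ξ.left ⁻¹ᵁ U)),
      a ≫ restrictOver ξ U = b ≫ restrictOver ξ U → a ≫ π = b ≫ π) :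
    ∃ f : openOver U ⟶ Q, restrictOver ξ U ≫ f = π := by
  have : IsAffine (U : Scheme) := hU
  have : IsAffine (ξ.left ⁻¹ᵁ U : Scheme) := hV
  have := hξ.flat
  have := hξ.surjective
  let ρ := ξ.left ∣_ U
  have hflat : Flat ρ := inferInstance
  have hsurj : Surjective ρ := IsZariskiLocalAtTarget.restrict hξ.surjective U
  -- A faithfully flat morphism of affine schemes is the coequalizer of its kernel pair; the
  -- hypothesis on $\pi$ is then applied to the two projections of that pair.
  have := isRegularEpi_of_flat_of_surjective_of_isAffine ρ
  have : Epi ρ := inferInstance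
  have hρ : ρ ≫ (openOver U).hom = (openOver (ξ.left ⁻¹ᵁ U)).hom := Over.w (restrictOver ξ U)
  obtain ⟨f, hf⟩ := IsRegularEpi.exists_of_isKernelPair ρ (IsPullback.of_hasPullback ρ ρ) π.left (by
    let T : Over (Spec (CommRingCat.of R)) :=
      Over.mk (Limits.pullback.fst ρ ρ ≫ (openOver (ξ.left ⁻¹ᵁ U)).hom)
    let a : T ⟶ openOver (ξ.left ⁻¹ᵁ U) := Over.homMk (Limits.pullback.fst ρ ρ) rfl
    let b : T ⟶ openOver (ξ.left ⁻¹ᵁ U) := Over.homMk (Limits.pullback.snd ρ ρ) (by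
      rw [← hρ, ← Limits.pullback.condition_assoc]
      exact congr_arg (Limits.pullback.fst ρ ρ ≫ ·) hρ)
    exact congr_arg Over.Hom.left (h T a b (by ext1; exact Limits.pullback.condition)))
  refine ⟨Over.homMk f ?_, ?_⟩
  · rw [← cancel_epi ρ, reassoc_of% hf, hρ]
    exact Over.w π
  · ext1
    exact hf

lemma IsTorsor.epi_restrictOver {ξ : Y ⟶ X} (hξ : IsTorsor G ξ) (U : X.left.Opens) :
    Epi (restrictOver ξ U) := by
  have := hξ.flat
  have hsurj : Surjective (ξ.left ∣_ U) := IsZariskiLocalAtTarget.restrict hξ.surjective U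
  have : Epi (restrictOver ξ U).left := Flat.epi_of_flat_of_surjective (ξ.left ∣_ U)
  exact Over.epi_of_epi_left _

lemma isAffine_pullback {A B S : Scheme.{u}} (f : A ⟶ S) (g : B ⟶ S) [IsAffineHom f] [IsAffine B] :
    IsAffine (Limits.pullback f g) :=
  isAffine_of_isAffineHom (Limits.pullback.snd f g)

/-- If `U` trivialises `ξ`, then `ξ` has a section over `U`. -/
lemma Trivialises.exists_section [IsAffineHom G.hom] {ξ : Y ⟶ X} (hξ : IsTorsor G ξ)
    {U : X.left.Opens} (hU : IsAffineOpen U) (h : Trivialises G ξ U) :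
    ∃ s : openOver U ⟶ openOver (ξ.left ⁻¹ᵁ U), s ≫ restrictOver ξ U = 𝟙 _ := by
  obtain ⟨e, he⟩ := h
  have hV : IsAffineOpen (ξ.left ⁻¹ᵁ U) := by
    have : IsAffine (openOver U).left := hU
    have : IsAffine (G ⊗ openOver U).left := isAffine_pullback G.hom (openOver U).hom
    have : IsIso e.inv.left := inferInstanceAs (IsIso ((Over.forget _).map e.inv))
    exact IsAffine.of_isIso e.inv.left
  have hact : ∀ {T : Over (Spec (CommRingCat.of R))} (g h : T ⟶ G) (u : T ⟶ openOver U),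
      lift (lift g h ≫ μ[G]) u ≫ e.hom ≫ openOverι _ =
        lift g (lift h u ≫ e.hom ≫ openOverι _) ≫ act G Y := by
    intro T g h u
    have := congr_arg (lift g (lift h u) ≫ ·) he
    simpa [lift_mulMap] using this
  -- The trivialisation $e$ is not assumed to lie over $U$, so $u\mapsto e(1,u)$ need not be a
  -- section. The second coordinate of $e^{-1}$ is constant on fibres, since there $a=g\cdot b$ and
  -- $e$ is equivariant; it descends to $f:U\to U$ with $f(\xi(e(g,u)))=u$.
  obtain ⟨f, hf⟩ := hξ.exists_desc U hU hV (e.inv ≫ snd G _) fun T a b hab => by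
    have h1 : (a ≫ openOverι _) ≫ ξ = (b ≫ openOverι _) ≫ ξ := by
      simp only [Category.assoc, ← restrictOver_ι, reassoc_of% hab]
    obtain ⟨z, hz, hz'⟩ := hξ.exists_lift _ _ h1
    have h2 : a = lift (lift (z ≫ fst G Y) (b ≫ e.inv ≫ fst G _) ≫ μ[G])
        (b ≫ e.inv ≫ snd G _) ≫ e.hom := by
      rw [← cancel_mono (openOverι _), Category.assoc, hact]
      have h3 : lift (b ≫ e.inv ≫ fst G (openOver U)) (b ≫ e.inv ≫ snd G (openOver U)) =
          b ≫ e.inv := by ext1 <;> simp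
      rw [h3, Category.assoc, Iso.inv_hom_id_assoc, ← hz, ← hz']
      congr 1
      ext1 <;> simp [proj]
    rw [h2]
    simp
  have hepi := hξ.epi_restrictOver U
  -- The section is $x\mapsto e(1,f(x))$. Composing with the epimorphism $\xi\circ e$ reduces the
  -- claim to $\xi(e(1,u))=\xi(e(g,u))$, which holds because $e(g,u)=g\cdot e(1,u)$.
  let s : openOver U ⟶ openOver (ξ.left ⁻¹ᵁ U) := f ≫ unitMap G _ ≫ e.hom
  refine ⟨s, ?_⟩
  rw [← cancel_epi (restrictOver ξ U), ← cancel_epi e.hom, ← cancel_mono (openOverι _)]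
  have h1 := hact (fst G (openOver U)) (toUnit _ ≫ η[G]) (snd G (openOver U))
  have h2 : lift (fst G (openOver U)) (toUnit _ ≫ η[G]) ≫ μ[G] = fst G (openOver U) := by
    have := _root_.mul_one (fst G (openOver U))
    rwa [Hom.mul_def, Hom.one_def] at this
  have h3 : lift (fst G (openOver U)) (snd G (openOver U)) = 𝟙 _ := by ext1 <;> simp
  rw [h2, h3, Category.id_comp] at h1
  have h4 : lift (toUnit (G ⊗ openOver U) ≫ η[G]) (snd G (openOver U)) =
      snd G (openOver U) ≫ unitMap G (openOver U) := by ext1 <;> simp [unitMap]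
  have h5 : e.hom ≫ openOverι _ ≫ ξ = snd G _ ≫ unitMap G _ ≫ e.hom ≫ openOverι _ ≫ ξ := by
    conv_lhs => rw [reassoc_of% h1, hξ.invariant, h4]
    simp only [Category.assoc, lift_snd_assoc]
  simpa only [s, Category.assoc, Category.id_comp, restrictOver_ι, reassoc_of% hf,
    Iso.hom_inv_id_assoc] using h5.symm

/-- The cocycle identity of $M$ is pulled back along $r$; the three equations identify its three
terms with those of `Cocycle`. -/
lemma LocalSplitting.cocycle_of_eq {ξ : Y ⟶ X}
    (L : LocalSplitting ξ.left (act G Y).left (proj G Y).left) (M : EquivariantModule G Y)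
    (r : L.K ⟶ (G ⊗ (G ⊗ Y)).left) (e1 : r ≫ (projMap G Y).left = L.τV ≫ L.t)
    (e2 : r ≫ (actMap G Y).left = L.k) (e3 : r ≫ (mulMap G Y).left = L.σV ≫ L.t) :
    L.Cocycle M.α.hom := by
  have hf : r ≫ (actMap G Y).left ≫ (act G Y).left = L.k ≫ (act G Y).left := by
    rw [reassoc_of% e2]
  have hg : r ≫ (projMap G Y).left ≫ (act G Y).left = L.k ≫ (proj G Y).left := by
    rw [reassoc_of% e1, ← L.τV_t_σ, Category.assoc]
  have hh : r ≫ (projMap G Y).left ≫ (proj G Y).left = L.σV ≫ L.ξV ≫ L.s := by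
    rw [reassoc_of% e1, ← L.τV_t_τ, Category.assoc]
  have key := congr_arg (fun φ => baseChange φ r _ _ hf hh) M.cocycle
  rw [baseChange_comp _ _ _ _ _ _ hf hg hh,
    baseChange_baseChange _ _ _ _ _ _ _ _ e3 _ _ _ _ L.σV_t_σ L.σV_t_τ,
    baseChange_baseChange _ _ _ _ _ _ _ _ e2 _ _ _ _ rfl rfl,
    baseChange_baseChange _ _ _ _ _ _ _ _ e1 _ _ _ _ L.τV_t_σ L.τV_t_τ] at key
  exact key

/-- A locally trivial torsor has local splittings, for which every equivariant module satisfies the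
cocycle condition. -/
theorem IsLocallyTrivialTorsor.exists_localSplitting [IsAffineHom G.hom] {ξ : Y ⟶ X}
    (hξ : IsLocallyTrivialTorsor G ξ) (x : X.left) :
    ∃ L : LocalSplitting ξ.left (act G Y).left (proj G Y).left, x ∈ L.i.opensRange ∧
      ∀ M : EquivariantModule G Y, L.Cocycle M.α.hom := by
  obtain ⟨U, hx, hU, htriv, -⟩ := hξ.exists_trivialising x
  have htor := hξ.toIsTorsor
  obtain ⟨sV, hsV⟩ := htriv.exists_section htor hU
  have hs : (sV ≫ openOverι _) ≫ ξ = openOverι U := by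
    rw [Category.assoc, ← restrictOver_ι, reassoc_of% hsV]
  -- $y$ and $s(\xi y)$ lie in one fibre, so $t(y)=(h,s(\xi y))$ with $h\cdot s(\xi y)=y$.
  obtain ⟨t, ht, ht'⟩ := htor.exists_lift (openOverι (ξ.left ⁻¹ᵁ U))
    (restrictOver ξ U ≫ sV ≫ openOverι _) (by rw [Category.assoc, hs, restrictOver_ι])
  let O : (G ⊗ Y).left.Opens := (act G Y).left ⁻¹ᵁ ξ.left ⁻¹ᵁ U
  let k : openOver O ⟶ G ⊗ Y := openOverι O
  have hO : O = (proj G Y).left ⁻¹ᵁ ξ.left ⁻¹ᵁ U := by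
    dsimp only [O]
    rw [← Scheme.Hom.comp_preimage, invariant_left ξ htor.invariant]
    rfl
  obtain ⟨σV, hσV⟩ := exists_lift_openOverι (ξ.left ⁻¹ᵁ U) (k ≫ act G Y) fun z => z.2
  obtain ⟨τV, hτV⟩ := exists_lift_openOverι (ξ.left ⁻¹ᵁ U) (k ≫ proj G Y) fun z => by
    have : O.ι z ∈ (proj G Y).left ⁻¹ᵁ ξ.left ⁻¹ᵁ U := hO ▸ z.2
    exact this
  have hστ : σV ≫ restrictOver ξ U = τV ≫ restrictOver ξ U := by
    rw [← cancel_mono (openOverι U), Category.assoc, Category.assoc, restrictOver_ι,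
      reassoc_of% hσV, reassoc_of% hτV, htor.invariant]
  let L : LocalSplitting ξ.left (act G Y).left (proj G Y).left :=
    { W := U
      V := ξ.left ⁻¹ᵁ U
      K := O
      i := U.ι
      j := (ξ.left ⁻¹ᵁ U).ι
      k := O.ι
      ξV := (restrictOver ξ U).left
      σV := σV.left
      τV := τV.left
      s := (sV ≫ openOverι _).left
      sV := sV.left
      t := t.left
      ξV_i := congr_arg Over.Hom.left (restrictOver_ι ξ U)
      σV_j := congr_arg Over.Hom.left hσV
      τV_j := congr_arg Over.Hom.left hτV
      σV_ξV := congr_arg Over.Hom.left hστ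
      sV_j := rfl
      s_ξ := congr_arg Over.Hom.left hs
      sV_ξV := congr_arg Over.Hom.left hsV
      t_σ := congr_arg Over.Hom.left ht
      t_τ := congr_arg Over.Hom.left ht'
      preimage_le_j := by rw [Scheme.Opens.opensRange_ι, Scheme.Opens.opensRange_ι]
      preimage_le_k := by rw [Scheme.Opens.opensRange_ι, Scheme.Opens.opensRange_ι] }
  refine ⟨L, by simpa [L] using hx, fun M => ?_⟩
  -- $r(g,y)=(g,h,s(\xi y))$ with $h\cdot s(\xi y)=y$. Multiplying gives $(gh,s(\xi y))$, which is
  -- $t(gy)$ by freeness of the action.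
  let r : openOver O ⟶ G ⊗ (G ⊗ Y) := lift (k ≫ fst G Y) (τV ≫ t)
  have hr1 : r ≫ projMap G Y = τV ≫ t := lift_snd _ _
  have hr2 : r ≫ actMap G Y = k := by
    dsimp only [r, actMap]
    rw [lift_whiskerLeft, Category.assoc, ht, hτV]
    ext1
    · simp
    · simp
  have hr3 : r ≫ mulMap G Y = σV ≫ t := by
    apply htor.hom_ext
    · rw [Category.assoc, mulMap_act, reassoc_of% hr2, Category.assoc, ht, hσV]
    · rw [Category.assoc, mulMap_proj, reassoc_of% hr1, Category.assoc, ht',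
        ← reassoc_of% hστ]
  have e1 : r.left ≫ (projMap G Y).left = τV.left ≫ t.left := congr_arg Over.Hom.left hr1
  have e2 : r.left ≫ (actMap G Y).left = O.ι := congr_arg Over.Hom.left hr2
  have e3 : r.left ≫ (mulMap G Y).left = σV.left ≫ t.left := congr_arg Over.Hom.left hr3
  exact L.cocycle_of_eq M r.left e1 e2 e3

end TorsorSections

/-! ### The unit and the counit are isomorphisms -/

lemma isIso_pullback_map_iff {T Z Y : Scheme.{u}} (a : T ⟶ Z) (b : Z ⟶ Y) (f : T ⟶ Y)
    (h : a ≫ b = f) {M N : Y.Modules} (φ : M ⟶ N) :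
    IsIso ((Scheme.Modules.pullback f).map φ) ↔
      IsIso ((Scheme.Modules.pullback a).map ((Scheme.Modules.pullback b).map φ)) :=
  (NatIso.isIso_map_iff (pullbackComp' a b f h) φ).symm

namespace EquivariantModule

variable {R : Type u} [CommRing R] {G Y : Over (Spec (CommRingCat.of R))} [GrpObj G] [ModObj G Y]

lemma isIso_of_isIso_hom {M N : EquivariantModule G Y} (f : M ⟶ N) [IsIso f.hom] : IsIso f := by
  let g : N ⟶ M :=
    { hom := inv f.hom
      comm := by
        rw [Functor.map_inv, Functor.map_inv, IsIso.inv_comp_eq, ← Category.assoc,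
          IsIso.eq_comp_inv, f.comm] }
  exact ⟨g, hom_ext _ _ (IsIso.hom_inv_id f.hom), hom_ext _ _ (IsIso.inv_hom_id f.hom)⟩

instance isIso_hom {M N : EquivariantModule G Y} (f : M ⟶ N) [IsIso f] : IsIso f.hom :=
  ⟨Hom.hom (inv f), by rw [← comp_hom, IsIso.hom_inv_id, id_hom],
    by rw [← comp_hom, IsIso.inv_hom_id, id_hom]⟩

end EquivariantModule

section Equivalence

variable {R : Type u} [CommRing R] {G Y X : Over (Spec (CommRingCat.of R))} [GrpObj G] [ModObj G Y]
  (ξ : Y ⟶ X) (hξ : act G Y ≫ ξ = proj G Y ≫ ξ)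

/-- The sections of `(ξ_* M)^G` over `U` are the invariant sections of `M` over `ξ⁻¹(U)`. -/
def invariantSectionsIsLimit (M : EquivariantModule G Y) (U : X.left.Opens)
    (w : (invariantι ξ hξ M).app U ≫ pullSection (act G Y).left M.obj (ξ.left ⁻¹ᵁ U)
        (((proj G Y).left ≫ ξ.left) ⁻¹ᵁ U) (preimage_le_act ξ hξ U) ≫ M.α.hom.app _ =
      (invariantι ξ hξ M).app U ≫ pullSection (proj G Y).left M.obj (ξ.left ⁻¹ᵁ U)
        (((proj G Y).left ≫ ξ.left) ⁻¹ᵁ U) le_rfl) :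
    Limits.IsLimit (Limits.Fork.ofι ((invariantι ξ hξ M).app U) w) := by
  -- Taking sections over $U$ preserves equalizers.
  let F : X.left.Modules ⥤ Ab :=
    Scheme.Modules.toPresheaf X.left ⋙ (evaluation _ _).obj (Opposite.op U)
  have : Limits.PreservesLimitsOfShape Limits.WalkingParallelPair F :=
    have := Limits.evaluation_preservesLimitsOfShape (J := Limits.WalkingParallelPair)
      (C := Ab.{u}) (Opposite.op U)
    Limits.comp_preservesLimitsOfShape _ _
  have h1 := Limits.isLimitForkMapOfIsLimit F (invariantι_condition ξ hξ M)
    (Limits.equalizerIsEqualizer (actSection ξ hξ M) (projSection ξ M))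
  have h2 : F.map (actSection ξ hξ M) = _ := actSection_app ξ hξ M U
  have h3 : F.map (projSection ξ M) = _ := projSection_app ξ M U
  have key : ∀ {A B : Ab} {D D' P P' : A ⟶ B} {E : Ab} (c : E ⟶ A) (w : c ≫ D = c ≫ P)
      (w' : c ≫ D' = c ≫ P') (_ : D = D') (_ : P = P')
      (_ : Limits.IsLimit (Limits.Fork.ofι c w)), Limits.IsLimit (Limits.Fork.ofι c w') := by
    intro A B D D' P P' E c w w' hD hP h
    subst hD hP
    exact h
  exact key _ _ w h2 h3 h1

/-- The isomorphism $m\mapsto s^*m$ on invariants factors as $i^*$ of sections, the canonical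
$i^*\cong s^*\xi^*$, and then $s^*$ of the counit. The first two are invertible over opens in the
range of $i$, hence so is the third. -/
lemma isIso_pullback_s_map_invariantCounit
    (L : LocalSplitting ξ.left (act G Y).left (proj G Y).left)
    (M : EquivariantModule G Y) (hM : L.Cocycle M.α.hom) :
    IsIso ((Scheme.Modules.pullback L.s).map (invariantCounit ξ hξ M)) := by
  have key : ∀ U : X.left.Opens, U ≤ L.i.opensRange →
      IsIso (((Scheme.Modules.pullback L.s).map (invariantCounit ξ hξ M)).app (L.i ⁻¹ᵁ U)) := by
    intro U hU
    have w : (invariantι ξ hξ M).app U ≫ pullSection (act G Y).left M.obj (ξ.left ⁻¹ᵁ U)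
        (((proj G Y).left ≫ ξ.left) ⁻¹ᵁ U) (preimage_le_act ξ hξ U) ≫ M.α.hom.app _ =
      (invariantι ξ hξ M).app U ≫ pullSection (proj G Y).left M.obj (ξ.left ⁻¹ᵁ U)
        (((proj G Y).left ≫ ξ.left) ⁻¹ᵁ U) le_rfl := by
      have h := congr_arg (fun t => t.app U) (invariantι_condition ξ hξ M)
      simp only [Scheme.Modules.Hom.comp_app, actSection_app, projSection_app] at h
      exact h
    have h1 := L.isIso_comp_pullSection M.α.hom hM U hU (((proj G Y).left ≫ ξ.left) ⁻¹ᵁ U)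
      (by rw [← invariant_left ξ hξ]; rfl) rfl _ w (invariantSectionsIsLimit ξ hξ M U w)
    have h2 := isIso_pullSection L.i ((invariantPushforward ξ hξ).obj M) U _ le_rfl rfl hU
    have h3 := pullSection_inv_pullbackComp' L.s ξ.left L.i L.s_ξ
      ((invariantPushforward ξ hξ).obj M) U (ξ.left ⁻¹ᵁ U) (L.i ⁻¹ᵁ U) le_rfl (L.le_s U) le_rfl
    have h4 := pullSection_naturality L.s (invariantCounit ξ hξ M) (ξ.left ⁻¹ᵁ U) (L.i ⁻¹ᵁ U)
      (L.le_s U)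
    rw [← unitSection_invariantCounit, Category.assoc, ← h4, ← pullSection_eq_unitSection,
      ← reassoc_of% h3] at h1
    have h5 := @IsIso.of_isIso_comp_left _ _ _ _ _ _ _ _ h1
    exact @IsIso.of_isIso_comp_left _ _ _ _ _ _ _ _ h5
  rw [Scheme.Modules.Hom.isIso_iff_isIso_app]
  intro O
  -- Every open of $W$ is the preimage of its image under $i$.
  have := key (L.i ''ᵁ O) (L.i.image_le_opensRange O)
  rwa [Scheme.Hom.preimage_image_eq] at this

/-- As $j=\sigma t$ and $p\,t=s\,\xi_V$, equivariance conjugates $j^*\varphi\cong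
t^*\sigma^*\varphi$ into $t^*p^*\varphi\cong\xi_V^*s^*\varphi$. -/
lemma isIso_pullback_j_map (L : LocalSplitting ξ.left (act G Y).left (proj G Y).left)
    {M N : EquivariantModule G Y} (φ : M ⟶ N)
    (h : IsIso ((Scheme.Modules.pullback L.s).map φ.hom)) :
    IsIso ((Scheme.Modules.pullback L.j).map φ.hom) := by
  have h1 : IsIso ((Scheme.Modules.pullback (L.ξV ≫ L.s)).map φ.hom) := by
    rw [isIso_pullback_map_iff _ _ _ rfl]
    infer_instance
  rw [isIso_pullback_map_iff _ _ _ L.t_τ] at h1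
  rw [isIso_pullback_map_iff _ _ _ L.t_σ]
  have h2 : (Scheme.Modules.pullback (act G Y).left).map φ.hom =
      M.α.hom ≫ (Scheme.Modules.pullback (proj G Y).left).map φ.hom ≫ N.α.inv := by
    rw [← Category.assoc, Iso.eq_comp_inv, φ.comm]
  rw [h2, Functor.map_comp, Functor.map_comp]
  infer_instance

variable {ξ}

theorem IsLocallyTrivialTorsor.isIso_counit [IsAffineHom G.hom]
    (h : IsLocallyTrivialTorsor G ξ) : IsIso (invariantAdjunction ξ hξ).counit := by
  have (M : EquivariantModule G Y) : IsIso ((invariantAdjunction ξ hξ).counit.app M) := by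
    have : IsIso ((invariantAdjunction ξ hξ).counit.app M).hom := by
      apply isIso_of_isIso_pullback
      intro y
      obtain ⟨L, hL, hL'⟩ := h.exists_localSplitting (ξ.left y)
      exact ⟨L.V, L.j, inferInstance, L.preimage_le_j hL, isIso_pullback_j_map ξ L _
        (isIso_pullback_s_map_invariantCounit ξ hξ L M (hL' M))⟩
    exact EquivariantModule.isIso_of_isIso_hom _
  exact NatIso.isIso_of_isIso_app _

/-- With the counit invertible, the triangle identity inverts $\xi^*$ of the unit. As $s^*\xi^*\cong
i^*$, the unit is then invertible on a cover of $X$. -/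
theorem IsLocallyTrivialTorsor.isIso_unit [IsAffineHom G.hom]
    (h : IsLocallyTrivialTorsor G ξ) : IsIso (invariantAdjunction ξ hξ).unit := by
  have := h.isIso_counit hξ
  have (N : X.left.Modules) : IsIso ((invariantAdjunction ξ hξ).unit.app N) := by
    have h1 := (invariantAdjunction ξ hξ).left_triangle_components N
    have h2 : IsIso ((equivariantPullback ξ hξ).map ((invariantAdjunction ξ hξ).unit.app N)) := by
      rw [← IsIso.eq_comp_inv] at h1
      rw [h1]
      infer_instance
    have h3 : IsIso ((Scheme.Modules.pullback ξ.left).map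
      ((invariantAdjunction ξ hξ).unit.app N)) :=
      EquivariantModule.isIso_hom ((equivariantPullback ξ hξ).map _)
    apply isIso_of_isIso_pullback
    intro x
    obtain ⟨L, hL, -⟩ := h.exists_localSplitting x
    refine ⟨L.W, L.i, inferInstance, hL, ?_⟩
    rw [isIso_pullback_map_iff _ _ _ L.s_ξ]
    infer_instance
  exact NatIso.isIso_of_isIso_app _

/-- Locally $i^*(\xi_*M)^G\cong s^*\xi^*(\xi_*M)^G\cong s^*M$, the last step by the counit, and
pullbacks preserve quasi-coherence. -/
lemma IsLocallyTrivialTorsor.isQCoh_invariantPushforward [IsAffineHom G.hom]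
    (h : IsLocallyTrivialTorsor G ξ) (M : EquivariantModule G Y) (hM : isQCoh Y.left M.obj) :
    isQCoh X.left ((invariantPushforward ξ hξ).obj M) := by
  apply isQCoh_of_isQCoh_pullback
  intro x
  obtain ⟨L, hL, hL'⟩ := h.exists_localSplitting x
  refine ⟨L.W, L.i, inferInstance, hL, ?_⟩
  have := isIso_pullback_s_map_invariantCounit ξ hξ L M (hL' M)
  exact isQCoh_of_iso ((asIso ((Scheme.Modules.pullback L.s).map (invariantCounit ξ hξ M))).symm ≪≫
    (pullbackComp' L.s ξ.left L.i L.s_ξ).app _) (isQCoh_pullback L.s hM)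

end Equivalence

end EquivDescent

end

/-! ### Restriction of the adjunction to quasi-coherent modules -/

theorem mainTheorem6 {R : Type u} [CommRing R]
    (G Y X : Over (Spec (CommRingCat.of R))) [GrpObj G] [ModObj G Y]
    [IsAffineHom G.hom] [Smooth G.hom] [LocallyOfFiniteType G.hom] [QuasiCompact G.hom]
    (ξ : Y ⟶ X) (hξ : IsLocallyTrivialTorsor G ξ) :
    ∃ (hpush : ∀ M : QCohEquivariant G Y,
          isQCoh X.left ((invariantPushforward ξ hξ.invariant).obj M.obj))
      (hpull : ∀ N : QCoh X.left,
          isQCohEquivariant G Y ((equivariantPullback ξ hξ.invariant).obj N.obj))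
      (e : QCohEquivariant G Y ≌ QCoh X.left),
      e.functor = ObjectProperty.lift _
          ((isQCohEquivariant G Y).ι ⋙ invariantPushforward ξ hξ.invariant) hpush ∧
      e.inverse = ObjectProperty.lift _
          ((isQCoh X.left).ι ⋙ equivariantPullback ξ hξ.invariant) hpull := by
  have h1 := hξ.isIso_counit hξ.invariant
  have h2 := hξ.isIso_unit hξ.invariant
  have hpush : ∀ M : QCohEquivariant G Y,
      isQCoh X.left ((invariantPushforward ξ hξ.invariant).obj M.obj) := fun M =>
    hξ.isQCoh_invariantPushforward hξ.invariant M.obj M.property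
  have hpull : ∀ N : QCoh X.left,
      isQCohEquivariant G Y ((equivariantPullback ξ hξ.invariant).obj N.obj) := fun N =>
    isQCoh_pullback ξ.left N.property
  let F : QCohEquivariant G Y ⥤ QCoh X.left := ObjectProperty.lift _
    ((isQCohEquivariant G Y).ι ⋙ invariantPushforward ξ hξ.invariant) hpush
  let F' : QCoh X.left ⥤ QCohEquivariant G Y := ObjectProperty.lift _
    ((isQCoh X.left).ι ⋙ equivariantPullback ξ hξ.invariant) hpull
  let adj : F' ⊣ F := (invariantAdjunction ξ hξ.invariant).restrictFullyFaithful
    (isQCoh X.left).fullyFaithfulι (isQCohEquivariant G Y).fullyFaithfulι (Iso.refl _) (Iso.refl _)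
  -- The inclusions of the full subcategories reflect isomorphisms and carry the restricted unit and
  -- counit to the original ones, up to identities.
  have h3 : IsIso adj.unit := by
    have (N : QCoh X.left) : IsIso (adj.unit.app N) := by
      have : IsIso ((isQCoh X.left).ι.map (adj.unit.app N)) := by
        rw [Adjunction.map_restrictFullyFaithful_unit_app]
        infer_instance
      exact isIso_of_reflects_iso _ (isQCoh X.left).ι
    exact NatIso.isIso_of_isIso_app _
  have h4 : IsIso adj.counit := by
    have (M : QCohEquivariant G Y) : IsIso (adj.counit.app M) := by
      have : IsIso ((isQCohEquivariant G Y).ι.map (adj.counit.app M)) := by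
        rw [Adjunction.map_restrictFullyFaithful_counit_app]
        infer_instance
      exact isIso_of_reflects_iso _ (isQCohEquivariant G Y).ι
    exact NatIso.isIso_of_isIso_app _
  exact ⟨hpush, hpull, adj.toEquivalence.symm, rfl, rfl⟩
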